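/- Let $K\subseteq F$ be fields, let $\Omega=\prod_{k\ge 0}\Omega_k$ be the completion (with respect to the grading) of a commutative graded $F$-algebra $\bigoplus_{k\ge0}\Omega_k$ with $\Omega_0=F$, and assume that $\Omega$ has no zero divisors. Let $\theta=\sum_k\theta^{(k)}\colon F\to\Omega$ be an iterable higher derivation over $K$ with $K=\{t\in F\mid \theta(t)=t\}$. Here a *higher derivation* is a homomorphism of $K$-algebras with $\theta^{(0)}=\mathrm{id}$, where $\theta^{(k)}\colon F\to\Omega_k$ denotes the degree-$k$ component; it is *iterable* if the graded algebra is generated as an $F$-algebra by the elements $\theta^{(k)}(r)$ ($k\ge 0$, $r\in F$), and $\theta$ extends to a continuous positive $K$-algebra endomorphism $\theta_\Omega$ of $\Omega$ (one that maps each $\prod_{k\ge m}\Omega_k$ into itself) whose homogeneous components satisfy $\theta_\Omega^{(i)}\circ\theta_\Omega^{(j)}=\binom{i+j}{i}\theta_\Omega^{(i+j)}$ for all $i,j\ge0$. The same definitions apply to any $F$-algebra $R$ and $R\otimes\Omega:=\prod_k R\otimes_F\Omega_k$ in place of $F$ and $\Omega$. A *$\theta$-ring* is a commutative $F$-algebra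 $R$ with an iterable higher derivation $\theta_R\colon R\to R\otimes\Omega$ extending $\theta$; a *$\theta$-ideal* is an ideal $I\subseteq R$ with $\theta_R^{(k)}(I)\subseteq I\otimes_F\Omega_k$ for all $k$. Let $A=\sum_k A_k\in\mathrm{GL}_n(\Omega)$ with $A_0=\mathbf 1$ and $\binom{k+l}{l}A_{k+l}=\sum_{i+j=l}\theta_\Omega^{(i)}(A_k)A_j$ for all $k,l\ge 0$. A *PPV-ring* for the equation $\theta(y)=Ay$ is a nonzero $\theta$-ring $R$ without $\theta$-ideals other than $0$ and $R$, whose ring of constants $\{r\mid\theta_R(r)=r\otimes1\}$ is $K$, and for which there is $Y\in\mathrm{GL}_n(R)$ with $\theta_R(Y)=AY$ such that $R$ is generated as an $F$-algebra by the entries of $Y$ and $\det(Y)^{-1}$. A *PPV-extension* $E/F$ is the field of fractions $E$ of a PPV-ring $R$. Its *Galois group scheme* is the affine $K$-group scheme representing the functor $L\mapsto \mathrm{Aut}^\theta(R\otimes_KL/F\otimes_KL)$ on commutative $K$-algebras, i.e. the group of $F\otimes_K L$-algebra automorphisms of $R\otimes_KL$ that commute with the higher derivation $r\otimes a\mapsto\theta_R(r)\otimes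 a$. Suppose that $p:=\operatorname{char}F>0$ and that $\operatorname{Ker}(\theta^{(1)})=F^p$. Then for every PPV-extension $E/F$, with PPV-ring $R$ as above, the following hold. 1. The extension $E/F$ is separable, that is, $F'\otimes_FE$ is reduced for every field extension $F'/F$. 2. The Galois group scheme of $E/F$ exists, is of finite type over $K$, and is reduced: the functor $L\mapsto \mathrm{Aut}^\theta(R\otimes_KL/F\otimes_KL)$ is represented by a finitely generated $K$-algebra $U$ such that $\operatorname{Spec}U$ is a reduced scheme. -/

import Mathlib

open scoped TensorProduct
open TensorProduct

universe u

noncomputable section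

namespace PPV

section Cga

variable {R S : Type u} [CommRing R] [CommRing S] [Algebra R S]

/-- The completion `∏ i, 𝒜 i` of the graded `R`-algebra `S = ⨁ i, 𝒜 i` with respect to the ideals
`⨁ i ≥ k, 𝒜 i`. The element `∑ i, b i` with `b i ∈ 𝒜 i` is written as the power series
`∑ i, b i * X ^ i`; sums and products of such series are those of the completion. -/
def cga (𝒜 : ℕ → Submodule R S) [GradedAlgebra 𝒜] : Subalgebra R (PowerSeries S) where
  carrier := {f | ∀ i, PowerSeries.coeff i f ∈ 𝒜 i}
  mul_mem' {f g} hf hg i := by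
    rw [PowerSeries.coeff_mul]
    refine Submodule.sum_mem _ fun x hx => ?_
    rw [← Finset.HasAntidiagonal.mem_antidiagonal.mp hx]
    exact SetLike.mul_mem_graded (hf x.1) (hg x.2)
  add_mem' {f g} hf hg i := by
    rw [map_add]
    exact Submodule.add_mem _ (hf i) (hg i)
  algebraMap_mem' r i := by
    rw [PowerSeries.algebraMap_apply, PowerSeries.coeff_C]
    split_ifs with h
    · subst h
      exact SetLike.algebraMap_mem_graded 𝒜 r
    · exact Submodule.zero_mem _

/-- The projection `cga 𝒜 → 𝒜 i` to the `i`-th homogeneous component. -/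
def cga.proj (𝒜 : ℕ → Submodule R S) [GradedAlgebra 𝒜] (i : ℕ) (f : cga 𝒜) : 𝒜 i :=
  ⟨PowerSeries.coeff i (f : PowerSeries S), f.2 i⟩

/-- The inclusion `𝒜 i → cga 𝒜` of the `i`-th homogeneous component. -/
def cga.incl (𝒜 : ℕ → Submodule R S) [GradedAlgebra 𝒜] (i : ℕ) (b : 𝒜 i) : cga 𝒜 :=
  ⟨PowerSeries.monomial i (b : S), fun j => by
    rw [PowerSeries.coeff_monomial]
    split_ifs with h
    · subst h
      exact b.2
    · exact Submodule.zero_mem _⟩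

/-- `cga 𝒜` is a cga over its own base ring `R`: the component of degree `0` is (a copy of) `R`. -/
structure IsCgaOverBase (𝒜 : ℕ → Submodule R S) : Prop where
  injective : Function.Injective (algebraMap R S)
  degree_zero : ∀ b ∈ 𝒜 0, ∃ r : R, algebraMap R S r = b

variable (K : Type u) [Field K] [Algebra K R] [Algebra K S] [IsScalarTower K R S]

/-- A higher derivation `θ : R → cga 𝒜` over `K`: a homomorphism of `K`-algebras whose
composition with the augmentation is the identity of `R`. -/
structure HigherDerivation (𝒜 : ℕ → Submodule R S) [GradedAlgebra 𝒜] where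
  toAlgHom : R →ₐ[K] cga 𝒜
  augmentation : ∀ r : R, (cga.proj 𝒜 0 (toAlgHom r) : S) = algebraMap R S r

variable {K} {𝒜 : ℕ → Submodule R S} [GradedAlgebra 𝒜]

/-- The homogeneous component `θ^(k) : R → 𝒜 k ⊆ S` of a higher derivation. -/
def HigherDerivation.comp (θ : HigherDerivation K 𝒜) (k : ℕ) : R →ₗ[K] S where
  toFun r := (cga.proj 𝒜 k (θ.toAlgHom r) : S)
  map_add' r s := by simp [cga.proj]
  map_smul' c r := by
    rw [map_smul]
    change PowerSeries.coeff k (c • ((θ.toAlgHom r : cga 𝒜) : PowerSeries S)) = _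
    rfl

/-- The homogeneous component `Θ^(i)` of degree `i` of an endomorphism of `cga 𝒜`, on
elements `b` of degree `l`. -/
def homComp (Θ : cga 𝒜 →ₐ[K] cga 𝒜) (i l : ℕ) (b : 𝒜 l) : 𝒜 (l + i) :=
  cga.proj 𝒜 (l + i) (Θ (cga.incl 𝒜 l b))

/-- `Θ` is a positive continuous endomorphism of the `K`-algebra `cga 𝒜` that extends `θ` and
satisfies the iteration rule `Θ^(i) ∘ Θ^(j) = (i + j).choose i • Θ^(i + j)`. Positive and
continuous means that `Θ` maps every ideal of the filtration into itself. -/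
structure IsIterativeExtension (θ : HigherDerivation K 𝒜) (Θ : cga 𝒜 →ₐ[K] cga 𝒜) : Prop where
  extends_base : ∀ r : R, Θ (algebraMap R (cga 𝒜) r) = θ.toAlgHom r
  filtered : ∀ (k : ℕ) (f : cga 𝒜), (∀ i < k, cga.proj 𝒜 i f = 0) →
    ∀ i < k, cga.proj 𝒜 i (Θ f) = 0
  iterate : ∀ (i j l : ℕ) (b : 𝒜 l),
    (homComp Θ i (l + j) (homComp Θ j l b) : S) = (i + j).choose i • (homComp Θ (i + j) l b : S)

/-- A higher derivation is iterable if the graded algebra is generated, as an algebra over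
`R`, by the elements `θ^(k) r`, and `θ` has an extension to `cga 𝒜` satisfying the iteration
rule (the extension is then unique). -/
structure HigherDerivation.IsIterable (θ : HigherDerivation K 𝒜) : Prop where
  generated : Algebra.adjoin R {s : S | ∃ (k : ℕ) (r : R), s = θ.comp k r} = ⊤
  iterative : ∃ Θ : cga 𝒜 →ₐ[K] cga 𝒜, IsIterativeExtension θ Θ

/-- The constants of `(R, θ)`: the elements `r` with `θ r = r`. -/
def HigherDerivation.constants (θ : HigherDerivation K 𝒜) : Set R :=
  {r | θ.toAlgHom r = algebraMap R (cga 𝒜) r}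

/-- The condition on `A ∈ GL_n (cga 𝒜)` that `θ y = A y` is an iterable higher differential
equation: `A_0 = 1` and `(k + l).choose l • A_(k+l) = ∑_{i+j=l} θ^(i) (A_k) * A_j`. -/
def IsIHDE (θ : HigherDerivation K 𝒜) {n : ℕ} (A : GL (Fin n) (cga 𝒜)) : Prop :=
  (∀ i j, (cga.proj 𝒜 0 (A.val i j) : S) = if i = j then 1 else 0) ∧
  ∃ Θ : cga 𝒜 →ₐ[K] cga 𝒜, IsIterativeExtension θ Θ ∧
    ∀ (k l : ℕ) (i j : Fin n),
      (k + l).choose l • (cga.proj 𝒜 (k + l) (A.val i j) : S) =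
        ∑ ab ∈ Finset.HasAntidiagonal.antidiagonal l, ∑ m : Fin n,
          (homComp Θ ab.1 k (cga.proj 𝒜 k (A.val i m)) : S) *
            (cga.proj 𝒜 ab.2 (A.val m j) : S)

end Cga

section ThetaRing

variable {K F S : Type u} [Field K] [Field F] [CommRing S] [Algebra K F] [Algebra F S]
  [Algebra K S] [IsScalarTower K F S] {𝒜 : ℕ → Submodule F S} [GradedAlgebra 𝒜]

/-- The structure of a `θ`-ring on an `F`-algebra `R`: an iterable higher derivation
`θ_R : R → R ⊗ cga 𝒜` that extends `θ`. Here `R ⊗ cga 𝒜` is the cga over `R` with homogeneous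
components `R ⊗[F] 𝒜 k`. -/
structure ThetaRing (θ : HigherDerivation K 𝒜) (R : Type u) [CommRing R] [Algebra F R]
    [Algebra K R] [IsScalarTower K F R] where
  der : HigherDerivation K (fun i => (𝒜 i).baseChange R)
  iterable : der.IsIterable
  extends_base : ∀ (k : ℕ) (x : F), der.comp k (algebraMap F R x) = 1 ⊗ₜ[F] θ.comp k x

variable {θ : HigherDerivation K 𝒜} {R : Type u} [CommRing R] [Algebra F R]
  [Algebra K R] [IsScalarTower K F R]

/-- `I` is a `θ`-ideal: `θ_R^(k) I ⊆ I ⊗ 𝒜 k` for all `k`. -/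
def ThetaRing.IsThetaIdeal (θR : ThetaRing θ R) (I : Ideal R) : Prop :=
  ∀ k : ℕ, ∀ x ∈ I, θR.der.comp k x ∈
    Submodule.map₂ (TensorProduct.mk F R S) (I.restrictScalars F) (𝒜 k)

/-- `R` is `θ`-simple: it is nonzero and has no proper nontrivial `θ`-ideals. -/
def ThetaRing.IsSimple (θR : ThetaRing θ R) : Prop :=
  Nontrivial R ∧ ∀ I : Ideal R, θR.IsThetaIdeal I → I = ⊥ ∨ I = ⊤

/-- `Y ∈ GL_n (R)` is a fundamental solution matrix: `θ_R Y = A Y`. In degree `k` this is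
`θ_R^(k) (Y_ij) = ∑_m (A_k)_im * Y_mj` in `R ⊗[F] 𝒜 k`. -/
def ThetaRing.IsFundamentalMatrix (θR : ThetaRing θ R) {n : ℕ} (A : GL (Fin n) (cga 𝒜))
    (Y : GL (Fin n) R) : Prop :=
  ∀ (k : ℕ) (i j : Fin n),
    θR.der.comp k (Y.val i j) = ∑ m : Fin n, Y.val m j ⊗ₜ[F] (cga.proj 𝒜 k (A.val i m) : S)

/-- `R` is a pseudo Picard-Vessiot ring for the equation `θ y = A y`. -/
structure ThetaRing.IsPPVRing (θR : ThetaRing θ R) {n : ℕ} (A : GL (Fin n) (cga 𝒜)) : Prop where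
  simple : θR.IsSimple
  fundamental : ∃ Y : GL (Fin n) R, θR.IsFundamentalMatrix A Y ∧
    Algebra.adjoin F
      (Set.range (fun ij : Fin n × Fin n => Y.val ij.1 ij.2) ∪ {((Matrix.GeneralLinearGroup.det Y)⁻¹).val}) = ⊤
  constants_eq : θR.der.constants = Set.range (algebraMap K R)

/-- The component of degree `k` of the trivial extension of `θ_R` to `R_L = R ⊗[K] L`, namely
`r ⊗ a ↦ θ_R^(k) r ⊗ a`, with values in `R_L ⊗[F] 𝒜 k`. -/
def ThetaRing.extComp (θR : ThetaRing θ R) (L : Type u) [CommRing L] [Algebra K L] (k : ℕ) :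
    R ⊗[K] L →ₗ[K] (R ⊗[K] L) ⊗[F] S :=
  TensorProduct.lift <| LinearMap.mk₂ K
    (fun r a => Algebra.TensorProduct.map
        (Algebra.TensorProduct.includeLeft : R →ₐ[F] R ⊗[K] L) (AlgHom.id F S)
        (θR.der.comp k r) * (((1 : R) ⊗ₜ[K] a) ⊗ₜ[F] (1 : S)))
    (fun r s a => by rw [map_add, map_add, add_mul])
    (fun c r a => by
      rw [map_smul, ← smul_mul_assoc, ← algebraMap_smul F c (θR.der.comp k r), map_smul,
        algebraMap_smul])
    (fun r a b => by rw [TensorProduct.tmul_add, TensorProduct.add_tmul, mul_add])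
    (fun c r a => by
      rw [TensorProduct.tmul_smul, ← TensorProduct.smul_tmul', mul_smul_comm])

/-- The group `Aut^θ (R_L / F_L)`: automorphisms of the ring `R_L = R ⊗[K] L` that fix
`F_L = F ⊗[K] L` elementwise (equivalently: are `F`-linear and fix `1 ⊗ L`) and commute with the
trivial extension of `θ_R` to `R_L`. -/
def ThetaRing.autGroup (θR : ThetaRing θ R) (L : Type u) [CommRing L] [Algebra K L] :
    Subgroup ((R ⊗[K] L) ≃ₐ[F] (R ⊗[K] L)) where
  carrier := {σ | (∀ a : L, σ (1 ⊗ₜ[K] a) = 1 ⊗ₜ[K] a) ∧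
    ∀ (k : ℕ) (x : R ⊗[K] L), θR.extComp L k (σ x) =
      Algebra.TensorProduct.map (σ : (R ⊗[K] L) →ₐ[F] (R ⊗[K] L)) (AlgHom.id F S)
        (θR.extComp L k x)}
  one_mem' := by
    refine ⟨fun a => rfl, fun k x => ?_⟩
    have h : Algebra.TensorProduct.map
        ((1 : (R ⊗[K] L) ≃ₐ[F] (R ⊗[K] L)) : (R ⊗[K] L) →ₐ[F] (R ⊗[K] L)) (AlgHom.id F S) =
        AlgHom.id F _ := Algebra.TensorProduct.map_id
    rw [h]
    rfl
  mul_mem' {σ τ} hσ hτ := by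
    refine ⟨fun a => ?_, fun k x => ?_⟩
    · rw [AlgEquiv.mul_apply, hτ.1, hσ.1]
    · have h : Algebra.TensorProduct.map
          ((σ * τ : (R ⊗[K] L) ≃ₐ[F] (R ⊗[K] L)) : (R ⊗[K] L) →ₐ[F] (R ⊗[K] L))
          (AlgHom.id F S) =
          (Algebra.TensorProduct.map (σ : (R ⊗[K] L) →ₐ[F] (R ⊗[K] L)) (AlgHom.id F S)).comp
          (Algebra.TensorProduct.map (τ : (R ⊗[K] L) →ₐ[F] (R ⊗[K] L)) (AlgHom.id F S)) := by
        ext <;> rfl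
      rw [AlgEquiv.mul_apply, hσ.2, hτ.2, h]
      rfl
  inv_mem' {σ} hσ := by
    refine ⟨fun a => ?_, fun k x => ?_⟩
    · rw [AlgEquiv.aut_inv, AlgEquiv.symm_apply_eq, hσ.1]
    · have h : (Algebra.TensorProduct.map
          ((σ⁻¹ : (R ⊗[K] L) ≃ₐ[F] (R ⊗[K] L)) : (R ⊗[K] L) →ₐ[F] (R ⊗[K] L))
          (AlgHom.id F S)).comp
          (Algebra.TensorProduct.map (σ : (R ⊗[K] L) →ₐ[F] (R ⊗[K] L)) (AlgHom.id F S)) =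
          AlgHom.id F _ := by
        rw [← Algebra.TensorProduct.map_comp, ← Algebra.TensorProduct.map_id]
        congr 1
        exact AlgHom.ext fun y => σ.symm_apply_apply y
      have h2 := hσ.2 k (σ⁻¹ x)
      rw [show σ (σ⁻¹ x) = x from σ.apply_symm_apply x] at h2
      rw [h2, ← AlgHom.comp_apply, h]
      rfl

/-- The `K`-algebra `U` represents the group functor `L ↦ Aut^θ (R_L / F_L)` on `K`-algebras, so
that `Spec U` is the Galois group scheme of `R` over `F`: there are bijections
`Hom_K (U, L) ≃ Aut^θ (R_L / F_L)`, natural in `L`. The functor sends `f : L → L'` to base change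
along `f`, and the base change of `σ` is the only element of `Aut^θ (R_L' / F_L')` that is
compatible with `σ` through `id ⊗ f : R_L → R_L'`. -/
structure ThetaRing.RepresentsAut (θR : ThetaRing θ R) (U : Type u) [CommRing U]
    [Algebra K U] where
  equiv : ∀ (L : Type u) [CommRing L] [Algebra K L], (U →ₐ[K] L) ≃ θR.autGroup L
  natural : ∀ (L L' : Type u) [CommRing L] [Algebra K L] [CommRing L'] [Algebra K L']
    (f : L →ₐ[K] L') (g : U →ₐ[K] L) (x : R ⊗[K] L),
    (equiv L' (f.comp g)).val (Algebra.TensorProduct.map (AlgHom.id K R) f x) =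
      Algebra.TensorProduct.map (AlgHom.id K R) f ((equiv L g).val x)

end ThetaRing

/-- A (not necessarily algebraic) field extension `E / F` is separable if `F' ⊗[F] E` is reduced
for every field extension `F' / F`. -/
def IsSeparableExtension (F E : Type u) [Field F] [Field E] [Algebra F E] : Prop :=
  ∀ (F' : Type u) [Field F'] [Algebra F F'], IsReduced (F' ⊗[F] E)

end PPV

end

/-! Both claims follow from one fact: `p`-th powers of `F`-independent elements of `R` are again
`F`-independent (`ThetaRing.linearIndependent_pow`). In a shortest relation `v_a ^ p = ∑ c_i v_i ^
p`, apply `θ^(1)`. It kills `p`-th powers, so `∑ v_i ^ p ⊗ θ^(1) c_i = 0`, whence `θ^(1) c_i = 0`.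
By the hypothesis on the kernel `c_i = b_i ^ p`, and since `R` is reduced, `v_a = ∑ b_i v_i`.

Clearing denominators carries this fact over to `E`. MacLane's criterion then makes `F' ⊗ E`
reduced, and the same criterion makes `R ⊗[F] R` reduced.

The coordinate ring of the Galois group scheme is found inside `R ⊗[F] R`. It is the `K`-algebra `U`
generated by the entries of `Z = (Y ⊗ 1)⁻¹ (1 ⊗ Y)` and of `Z⁻¹`. It is of finite type by
construction, and reduced as a subring of a reduced ring.

That `U` represents the automorphism functor is the torsor argument. The entries of `Z` are
constants, and constants independent over `K` stay independent over the `θ`-simple ring `R`, so `R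
⊗[K] U → R ⊗[F] R` is injective. Its image contains `1 ⊗ R`, since `(Y ⊗ 1) Z = 1 ⊗ Y`. Pulling `1 ⊗
R` back gives a coaction `Y ↦ Y Z`, and thus an automorphism for each point of `U`. Conversely, an
automorphism `σ` over `L` gives the constant matrix `Y⁻¹ σ(Y)`. Its entries lie in `L` because the
constants of `R ⊗[K] L` are `L`, so it is a point of `U`. -/

noncomputable section

namespace PPV

/-! ### Linear functionals on the second tensor factor -/

section Contract

variable {k B B' V : Type*} [Field k] [CommRing B] [Algebra k B] [CommRing B'] [Algebra k B']
  [AddCommGroup V] [Module k V]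

/-- The `B`-linear contraction `b ⊗ v ↦ φ v • b` by a linear functional `φ`. -/
def contract (B : Type*) [CommRing B] [Algebra k B] (φ : V →ₗ[k] k) : B ⊗[k] V →ₗ[B] B :=
  (AlgebraTensorModule.rid k B B).toLinearMap ∘ₗ φ.baseChange B

@[simp]
theorem contract_tmul (φ : V →ₗ[k] k) (b : B) (v : V) :
    contract B φ (b ⊗ₜ[k] v) = φ v • b := by
  simp [contract]

/-- The coordinates of `x` in a basis of `W` are themselves contractions: a retraction `q` of `V`
onto `W` extends the coordinate functionals to `V`. This reduces `θ`-ideals and constants to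
conditions on elements of `B`. -/
theorem mem_map₂_of_contract_mem {W : Submodule k V} {I : Submodule k B} {x : B ⊗[k] V}
    (hx : x ∈ W.baseChange B) (h : ∀ φ : V →ₗ[k] k, contract B φ x ∈ I) :
    x ∈ Submodule.map₂ (TensorProduct.mk k B V) I W := by
  obtain ⟨q, hq⟩ := W.subtype.exists_leftInverse_of_injective W.ker_subtype
  let b := Module.Basis.ofVectorSpace k W
  have hx' : ∃ z : B ⊗[k] W, W.subtype.baseChange B z = x := by
    rw [Submodule.baseChange] at hx
    exact hx
  obtain ⟨z, rfl⟩ := hx'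
  have hz : ∀ i, contract B (b.coord i ∘ₗ q) (W.subtype.baseChange B z) =
      (b.baseChange B).repr z i := by
    intro i
    clear hx h
    induction z using TensorProduct.induction_on with
    | zero => simp
    | add x y hx hy => simp_all
    | tmul c w =>
      have := LinearMap.congr_fun hq w
      simp only [LinearMap.comp_apply, Submodule.subtype_apply, LinearMap.id_apply] at this
      simp [this, Algebra.smul_def, mul_comm]
  rw [← (b.baseChange B).linearCombination_repr z, Finsupp.linearCombination_apply,
    Finsupp.sum, map_sum]
  refine Submodule.sum_mem _ fun i _ => ?_
  rw [← hz i]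
  have : W.subtype.baseChange B (contract B (b.coord i ∘ₗ q) (W.subtype.baseChange B z) •
      (b.baseChange B) i) = TensorProduct.mk k B V
        (contract B (b.coord i ∘ₗ q) (W.subtype.baseChange B z)) (b i : V) := by
    simp [TensorProduct.smul_tmul']
  rw [this]
  exact Submodule.apply_mem_map₂ _ (h _) (b i).2

theorem eq_zero_of_contract_eq_zero {x : B ⊗[k] V}
    (h : ∀ φ : V →ₗ[k] k, contract B φ x = 0) : x = 0 := by
  have := mem_map₂_of_contract_mem (W := ⊤) (I := ⊥) (x := x) (by simp) (by simpa using h)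
  simpa using this

theorem contract_rTensor (f : B →ₗ[k] B') (φ : V →ₗ[k] k) (x : B ⊗[k] V) :
    contract B' φ (f.rTensor V x) = f (contract B φ x) := by
  induction x using TensorProduct.induction_on with
  | zero => simp
  | add x y hx hy => simp_all
  | tmul c w => simp

theorem contract_map {C : Type*} [CommRing C] [Algebra k C] (f : B →ₐ[k] B') (φ : C →ₗ[k] k)
    (x : B ⊗[k] C) :
    contract B' φ (Algebra.TensorProduct.map f (AlgHom.id k C) x) = f (contract B φ x) :=
  contract_rTensor f.toLinearMap φ x

end Contract

/-- If `p`-th powers of `k`-independent elements of `E` are `k`-independent, then `B ⊗ E` is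
reduced for every reduced `k`-algebra `B`. -/
theorem isReduced_tensorProduct_of_linearIndependent_pow {k B : Type*} {E : Type u} [Field k]
    [CommRing B] [Algebra k B] [CommRing E] [Algebra k E] (p : ℕ) [Fact p.Prime] [CharP k p]
    [IsReduced B]
    (h : ∀ (ι : Type u) (v : ι → E), LinearIndependent k v →
      LinearIndependent k fun i => v i ^ p) :
    IsReduced (B ⊗[k] E) := by
  have hp : 1 < p := (Fact.out : p.Prime).one_lt
  -- It suffices that `z ^ p = 0` forces `z = 0`; the Frobenius is additive.
  rw [isReduced_iff_pow_one_lt p hp]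
  intro z hz
  let b := Module.Basis.ofVectorSpace k E
  nontriviality B ⊗[k] E
  have : CharP (B ⊗[k] E) p := charP_of_injective_algebraMap (algebraMap k (B ⊗[k] E)).injective p
  have hli := (h _ b b.linearIndependent)
  -- Extending the `p`-th powers to a `k`-basis of `E` makes their independence survive base change
  -- to `B`.
  have hB : LinearIndependent B fun i => (1 : B) ⊗ₜ[k] (b i ^ p) := by
    have := ((Module.Basis.sumExtend hli).baseChange B).linearIndependent.comp _ Sum.inl_injective
    convert this using 2 with i
    simp [Module.Basis.sumExtend]
    rfl
  rw [← (b.baseChange B).linearCombination_repr z, Finsupp.linearCombination_apply,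
    Finsupp.sum, sum_pow_char] at hz
  rw [linearIndependent_iff'] at hB
  have := hB ((b.baseChange B).repr z).support (fun i => (b.baseChange B).repr z i ^ p) (by
    rw [← hz]
    refine Finset.sum_congr rfl fun i _ => ?_
    rw [smul_pow]
    simp)
  apply (b.baseChange B).repr.injective
  ext i
  by_contra hi
  have h1 := this i (by simpa using hi)
  exact hi (by simpa using eq_zero_of_pow_eq_zero h1)

/-! ### Higher derivations as power series -/

section Series

variable {R S : Type u} [CommRing R] [CommRing S] [Algebra R S] {K : Type u} [Field K]
  [Algebra K R] [Algebra K S] [IsScalarTower K R S] {𝒜 : ℕ → Submodule R S} [GradedAlgebra 𝒜]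

/-- A higher derivation as a ring homomorphism to the ring of power series. -/
def HigherDerivation.series (θ : HigherDerivation K 𝒜) : R →+* PowerSeries S :=
  (cga 𝒜).val.toRingHom.comp θ.toAlgHom.toRingHom

theorem HigherDerivation.coeff_series (θ : HigherDerivation K 𝒜) (k : ℕ) (r : R) :
    PowerSeries.coeff k (θ.series r) = θ.comp k r :=
  rfl

theorem HigherDerivation.comp_zero (θ : HigherDerivation K 𝒜) (r : R) :
    θ.comp 0 r = algebraMap R S r :=
  θ.augmentation r

theorem HigherDerivation.comp_mem (θ : HigherDerivation K 𝒜) (k : ℕ) (r : R) :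
    θ.comp k r ∈ 𝒜 k :=
  (cga.proj 𝒜 k (θ.toAlgHom r)).2

theorem HigherDerivation.mem_constants_iff (θ : HigherDerivation K 𝒜) (r : R) :
    r ∈ θ.constants ↔ ∀ k, 0 < k → θ.comp k r = 0 := by
  have hC : ((algebraMap R (cga 𝒜) r : cga 𝒜) : PowerSeries S) =
      PowerSeries.C (algebraMap R S r) := PowerSeries.algebraMap_apply
  have : r ∈ θ.constants ↔ θ.series r = PowerSeries.C (algebraMap R S r) := by
    rw [← hC]
    exact Subtype.ext_iff
  rw [this, PowerSeries.ext_iff]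
  constructor
  · intro h k hk
    have := h k
    rwa [θ.coeff_series, PowerSeries.coeff_C, if_neg hk.ne'] at this
  · intro h k
    rw [θ.coeff_series, PowerSeries.coeff_C]
    split_ifs with hk
    · rw [hk, θ.comp_zero]
    · exact h k (Nat.pos_of_ne_zero hk)

theorem HigherDerivation.comp_one_mul (θ : HigherDerivation K 𝒜) (r s : R) :
    θ.comp 1 (r * s) = θ.comp 1 r * algebraMap R S s + algebraMap R S r * θ.comp 1 s := by
  rw [← θ.coeff_series, map_mul, PowerSeries.coeff_one_mul,
    ← PowerSeries.coeff_zero_eq_constantCoeff_apply,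
    ← PowerSeries.coeff_zero_eq_constantCoeff_apply]
  simp only [θ.coeff_series, θ.comp_zero]
  ring

theorem HigherDerivation.comp_one_pow_char (θ : HigherDerivation K 𝒜) (p : ℕ) [CharP R p]
    (r : R) : θ.comp 1 (r ^ p) = 0 := by
  rw [← θ.coeff_series, map_pow, PowerSeries.coeff_one_pow, ← map_natCast (algebraMap R S),
    CharP.cast_eq_zero]
  simp

end Series

section ThetaRing

variable {K F S : Type u} [Field K] [Field F] [CommRing S] [Algebra K F] [Algebra F S]
  [Algebra K S] [IsScalarTower K F S] {𝒜 : ℕ → Submodule F S} [GradedAlgebra 𝒜]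
  {θ : HigherDerivation K 𝒜} {R : Type u} [CommRing R] [Algebra F R]
  [Algebra K R] [IsScalarTower K F R]

/-! ### Independence of `p`-th powers from the kernel of `θ^(1)` -/

section LinearIndependentPow

theorem ThetaRing.comp_one_smul_pow_char (θR : ThetaRing θ R) (p : ℕ) [CharP R p] (c : F) (r : R) :
    θR.der.comp 1 (c • r ^ p) = (r ^ p) ⊗ₜ[F] θ.comp 1 c := by
  rw [Algebra.smul_def, θR.der.comp_one_mul, θR.der.comp_one_pow_char, θR.extends_base]
  simp [Algebra.TensorProduct.algebraMap_apply]

/-- Induction on a finite subfamily. The inductive hypothesis separates the terms `v_i ^ p ⊗ θ^(1)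
c_i`, which turns the coefficients into `p`-th powers; a `p`-th root of the relation can then be
taken. -/
theorem ThetaRing.linearIndependent_pow (θR : ThetaRing θ R) [IsReduced R] [Nontrivial R]
    (p : ℕ) [Fact p.Prime] [CharP F p]
    (hker : {x : F | θ.comp 1 x = 0} = Set.range (fun x : F => x ^ p))
    {ι : Type*} {v : ι → R} (hv : LinearIndependent F v) :
    LinearIndependent F fun i => v i ^ p := by
  classical
  have hp : p ≠ 0 := (Fact.out : p.Prime).ne_zero
  have : CharP R p := charP_of_injective_algebraMap (algebraMap F R).injective p
  rw [← linearIndepOn_univ_iff, linearIndepOn_iff_linearIndepOn_finset]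
  intro s _
  induction s using Finset.induction_on with
  | empty => simp
  | insert a s ha ih =>
    have ih := ih (Set.subset_univ _)
    rw [Finset.coe_insert, linearIndepOn_insert (by simpa using ha)]
    refine ⟨ih, fun hmem => ?_⟩
    rw [Submodule.mem_span_image_finset_iff_exists_fun'] at hmem
    obtain ⟨c, hc⟩ := hmem
    have hc1 : ∑ i ∈ s, (v i ^ p) ⊗ₜ[F] θ.comp 1 (c i) = 0 := by
      rw [← θR.der.comp_one_pow_char p (v a), ← hc, map_sum]
      exact Finset.sum_congr rfl fun i _ => (θR.comp_one_smul_pow_char p (c i) (v i)).symm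
    have hc2 : ∀ i ∈ s, ∃ b, b ^ p = c i := by
      intro i hi
      have : c i ∈ {x : F | θ.comp 1 x = 0} := by
        -- A functional `φ` on `S` turns the tensor relation into `∑ φ (θ^(1) c_i) • v_i ^ p = 0`,
        -- with coefficients in `F`.
        refine (Module.forall_dual_apply_eq_zero_iff F _).1 fun φ => ?_
        have := congrArg (contract R φ) hc1
        simp only [map_sum, contract_tmul, map_zero] at this
        exact linearIndepOn_finset_iff.1 ih _ this i hi
      rwa [hker] at this
    choose! b hb using hc2
    have h0 : (v a - ∑ i ∈ s, b i • v i) ^ p = 0 := by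
      rw [sub_pow_char, sum_pow_char, sub_eq_zero, ← hc]
      refine Finset.sum_congr rfl fun i hi => ?_
      rw [smul_pow, hb i hi]
    have h1 := sub_eq_zero.1 (eq_zero_of_pow_eq_zero h0)
    have h2 : LinearIndepOn F v (insert a (s : Set ι)) := hv.linearIndepOn _
    rw [linearIndepOn_insert (by simpa using ha)] at h2
    refine h2.2 ?_
    rw [Submodule.mem_span_image_finset_iff_exists_fun']
    exact ⟨b, h1.symm⟩

end LinearIndependentPow

/-! ### Constants and linear independence over a `θ`-simple ring -/

section Constants

/-- The constant series `b ⊗ 1`. -/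
def constSeries (S B : Type*) [CommRing S] [Algebra F S] [CommRing B] [Algebra F B] :
    B →+* PowerSeries (B ⊗[F] S) :=
  (PowerSeries.C).comp Algebra.TensorProduct.includeLeftRingHom

variable {B : Type u} [CommRing B] [Algebra F B]

/-- The higher derivation of `R` followed by the base change along `g : R → B`. -/
def ThetaRing.seriesAlong (θR : ThetaRing θ R) (g : R →ₐ[F] B) :
    R →+* PowerSeries (B ⊗[F] S) :=
  (PowerSeries.map (Algebra.TensorProduct.map g (AlgHom.id F S)).toRingHom).comp θR.der.series

theorem ThetaRing.coeff_seriesAlong (θR : ThetaRing θ R) (g : R →ₐ[F] B) (k : ℕ) (r : R) :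
    PowerSeries.coeff k (θR.seriesAlong g r) =
      Algebra.TensorProduct.map g (AlgHom.id F S) (θR.der.comp k r) := by
  rw [ThetaRing.seriesAlong, RingHom.comp_apply, PowerSeries.coeff_map,
    HigherDerivation.coeff_series]
  rfl

theorem ThetaRing.seriesAlong_algebraMap (θR : ThetaRing θ R) (g : R →ₐ[F] B) (x : F) :
    θR.seriesAlong g (algebraMap F R x) = PowerSeries.map
      (Algebra.TensorProduct.includeRight : S →ₐ[F] B ⊗[F] S).toRingHom (θ.series x) := by
  ext k
  rw [θR.coeff_seriesAlong, PowerSeries.coeff_map, θR.extends_base, HigherDerivation.coeff_series]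
  simp

/-- The `φ`-coordinate of the component of degree `k`. -/
def contractCoeff (Φ : B →+* PowerSeries (B ⊗[F] S)) (k : ℕ) (φ : S →ₗ[F] F) : B →+ B :=
  (contract B φ).toAddMonoidHom.comp
    ((PowerSeries.coeff (R := B ⊗[F] S) k).toAddMonoidHom.comp Φ.toAddMonoidHom)

theorem contractCoeff_apply (Φ : B →+* PowerSeries (B ⊗[F] S)) (k : ℕ) (φ : S →ₗ[F] F) (b : B) :
    contractCoeff Φ k φ b = contract B φ (PowerSeries.coeff k (Φ b)) :=
  rfl

theorem contract_mul_tmul_one (φ : S →ₗ[F] F) (x : B ⊗[F] S) (b : B) :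
    contract B φ (x * (b ⊗ₜ[F] 1)) = contract B φ x * b := by
  have : x * (b ⊗ₜ[F] 1) = b • x := by
    rw [Algebra.smul_def, mul_comm]
    rfl
  rw [this, map_smul, smul_eq_mul, mul_comm]

/-- A constant series has only a term of degree `0`, so the coordinate operators are linear over
constants. -/
theorem contractCoeff_mul_const {Φ : B →+* PowerSeries (B ⊗[F] S)} (k : ℕ) (φ : S →ₗ[F] F)
    (b : B) {u : B} (hu : Φ u = constSeries S B u) :
    contractCoeff Φ k φ (b * u) = contractCoeff Φ k φ b * u := by
  rw [contractCoeff_apply, map_mul, hu, constSeries, RingHom.comp_apply, PowerSeries.coeff_mul_C]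
  exact contract_mul_tmul_one _ _ _

theorem contractCoeff_const {Φ : B →+* PowerSeries (B ⊗[F] S)} {k : ℕ} (hk : k ≠ 0)
    (φ : S →ₗ[F] F) {u : B} (hu : Φ u = constSeries S B u) :
    contractCoeff Φ k φ u = 0 := by
  rw [contractCoeff_apply, hu, constSeries, RingHom.comp_apply, PowerSeries.coeff_C, if_neg hk,
    map_zero]

theorem ThetaRing.mem_constants_of_contract (θR : ThetaRing θ R) {r : R}
    (h : ∀ k ≠ 0, ∀ φ : S →ₗ[F] F, contract R φ (θR.der.comp k r) = 0) :
    r ∈ θR.der.constants :=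
  (θR.der.mem_constants_iff r).2 fun k hk => eq_zero_of_contract_eq_zero (h k hk.ne')

/-- In a ring extension of a `θ`-simple ring whose constants are `K`, constants that are linearly
independent over `K` are linearly independent over the `θ`-simple ring. -/
theorem ThetaRing.linearIndependent_of_constants (θR : ThetaRing θ R) (hsimple : θR.IsSimple)
    (hconst : θR.der.constants = Set.range (algebraMap K R)) [Algebra R B] [IsScalarTower F R B]
    [Algebra K B] [IsScalarTower K R B] {Φ : B →+* PowerSeries (B ⊗[F] S)}
    (hΦ : ∀ r, Φ (algebraMap R B r) = θR.seriesAlong (IsScalarTower.toAlgHom F R B) r)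
    {ι : Type*} {u : ι → B} (hu : ∀ i, Φ (u i) = constSeries S B (u i))
    (hli : LinearIndependent K u) : LinearIndependent R u := by
  classical
  have hD : ∀ k φ r i, contractCoeff Φ k φ (r • u i) =
      contract R φ (θR.der.comp k r) • u i := by
    intro k φ r i
    rw [Algebra.smul_def, contractCoeff_mul_const k φ _ (hu i), contractCoeff_apply, hΦ,
      θR.coeff_seriesAlong, contract_map, Algebra.smul_def]
    rfl
  rw [← linearIndepOn_univ_iff, linearIndepOn_iff_linearIndepOn_finset]
  intro s _
  induction s using Finset.induction_on with
  | empty => simp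
  | insert a s ha ih =>
    have ih := ih (Set.subset_univ _)
    -- The ideal of possible coefficients of `u a` modulo the span of the other constants. It is a
    -- `θ`-ideal because, by `hD`, the coordinate operators act on combinations of the `u i` through
    -- their coefficients alone.
    let I : Ideal R :=
      (Submodule.span R (u '' s)).comap (LinearMap.toSpanSingleton R B (u a))
    have hI : ∀ r, r ∈ I ↔ r • u a ∈ Submodule.span R (u '' s) := fun r => Iff.rfl
    have hθ : θR.IsThetaIdeal I := by
      intro k x hx
      refine mem_map₂_of_contract_mem (θR.der.comp_mem k x) fun φ => ?_
      change _ ∈ I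
      rw [hI] at hx ⊢
      rw [← hD]
      rw [Submodule.mem_span_image_finset_iff_exists_fun'] at hx ⊢
      obtain ⟨c, hc⟩ := hx
      refine ⟨fun i => contract R φ (θR.der.comp k (c i)), ?_⟩
      rw [← hc, map_sum]
      exact Finset.sum_congr rfl fun i _ => (hD k φ (c i) i).symm
    rw [linearIndepOn_finset_iff] at ih ⊢
    rcases hsimple.2 I hθ with h | h
    · intro f hf
      rw [Finset.sum_insert ha] at hf
      have hfa : f a = 0 := by
        rw [← Submodule.mem_bot R, ← h, hI, Submodule.mem_span_image_finset_iff_exists_fun']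
        refine ⟨fun i => - f i, ?_⟩
        simp only [neg_smul, Finset.sum_neg_distrib]
        exact neg_eq_of_add_eq_zero_left hf
      rw [hfa, zero_smul, zero_add] at hf
      intro i hi
      rcases Finset.mem_insert.1 hi with rfl | hi
      · exact hfa
      · exact ih f hf i hi
    -- Here `u a = ∑ c_i u_i`. In positive degree the left side vanishes, so independence of the
    -- `u_i` makes every `c_i` a constant, hence an element of `K`. This contradicts independence
    -- over `K`.
    · exfalso
      have h1 : (1 : R) ∈ I := h ▸ Submodule.mem_top
      rw [hI, one_smul, Submodule.mem_span_image_finset_iff_exists_fun'] at h1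
      obtain ⟨c, hc⟩ := h1
      have hcK : ∀ i ∈ s, ∃ d : K, algebraMap K R d = c i := by
        intro i hi
        have : c i ∈ θR.der.constants := by
          refine θR.mem_constants_of_contract fun k hk φ => ?_
          refine ih (fun i => contract R φ (θR.der.comp k (c i))) ?_ i hi
          rw [← contractCoeff_const hk φ (hu a), ← hc, map_sum]
          exact Finset.sum_congr rfl fun i _ => (hD k φ (c i) i).symm
        rwa [hconst] at this
      choose! d hd using hcK
      have h2 : LinearIndepOn K u (insert a s : Finset ι) := hli.linearIndepOn _
      rw [linearIndepOn_finset_iff] at h2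
      have := h2 (fun i => if i = a then -1 else d i) (by
        rw [Finset.sum_insert ha, if_pos rfl, neg_smul, one_smul, ← hc, neg_add_eq_zero]
        refine Finset.sum_congr rfl fun i hi => ?_
        have hne : i ≠ a := by
          rintro rfl
          exact ha hi
        rw [if_neg hne, ← hd i hi, algebraMap_smul]) a (Finset.mem_insert_self _ _)
      simp at this

end Constants

end ThetaRing

/-! ### Gluing ring homomorphisms on a tensor product -/

section TensorLift

variable {k A B C : Type*} [CommRing k] [CommRing A] [CommRing B] [CommRing C] [Algebra k A]
  [Algebra k B]

/-- The ring homomorphism on a tensor product given by two ring homomorphisms that agree on the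
base. -/
def tensorLift (f : A →+* C) (g : B →+* C)
    (h : f.comp (algebraMap k A) = g.comp (algebraMap k B)) : A ⊗[k] B →+* C :=
  -- The structure on `C` comes from `f`. For higher derivations, `F` thus acts on power series
  -- through `θ` rather than through constants.
  letI := (f.comp (algebraMap k A)).toAlgebra
  (Algebra.TensorProduct.lift (S := k) { f with commutes' := fun _ => rfl }
    { g with commutes' := fun r => (RingHom.congr_fun h r).symm }
    fun _ _ => Commute.all _ _).toRingHom

theorem tensorLift_tmul (f : A →+* C) (g : B →+* C)
    (h : f.comp (algebraMap k A) = g.comp (algebraMap k B)) (a : A) (b : B) :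
    tensorLift f g h (a ⊗ₜ[k] b) = f a * g b :=
  rfl

end TensorLift

/-! ### Higher derivations on `R ⊗[F] R` and `R ⊗[K] L` -/

section ThetaRing

variable {K F S : Type u} [Field K] [Field F] [CommRing S] [Algebra K F] [Algebra F S]
  [Algebra K S] [IsScalarTower K F S] {𝒜 : ℕ → Submodule F S} [GradedAlgebra 𝒜]
  {θ : HigherDerivation K 𝒜} {R : Type u} [CommRing R] [Algebra F R]
  [Algebra K R] [IsScalarTower K F R] {B : Type u} [CommRing B] [Algebra F B]

open Matrix

/-- The image of an element of the cga as a power series over `B ⊗ S`. -/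
def cgaSeries (𝒜 : ℕ → Submodule F S) [GradedAlgebra 𝒜] (B : Type u) [CommRing B] [Algebra F B] :
    cga 𝒜 →+* PowerSeries (B ⊗[F] S) :=
  (PowerSeries.map (Algebra.TensorProduct.includeRight : S →ₐ[F] B ⊗[F] S).toRingHom).comp
    (cga 𝒜).val.toRingHom

theorem coeff_cgaSeries (k : ℕ) (a : cga 𝒜) :
    PowerSeries.coeff k (cgaSeries 𝒜 B a) = 1 ⊗ₜ[F] (cga.proj 𝒜 k a : S) :=
  rfl

theorem ThetaRing.IsFundamentalMatrix.map_seriesAlong {θR : ThetaRing θ R} {n : ℕ}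
    {A : GL (Fin n) (cga 𝒜)} {Y : GL (Fin n) R} (hY : θR.IsFundamentalMatrix A Y)
    (g : R →ₐ[F] B) :
    GeneralLinearGroup.map (θR.seriesAlong g) Y = GeneralLinearGroup.map (cgaSeries 𝒜 B) A *
      GeneralLinearGroup.map (constSeries S B) (GeneralLinearGroup.map (g : R →+* B) Y) := by
  ext i j k
  simp only [GeneralLinearGroup.map_apply, GeneralLinearGroup.coe_mul, Matrix.mul_apply, map_sum]
  rw [θR.coeff_seriesAlong, hY k i j, map_sum]
  refine Finset.sum_congr rfl fun m _ => ?_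
  rw [constSeries, RingHom.comp_apply, PowerSeries.coeff_mul_C, coeff_cgaSeries]
  simp

/-- Two solutions of the same equation differ by a constant matrix: in `(A Y)⁻¹ (A Y')` the factor
`A` cancels. -/
theorem map_inv_mul_eq_const {n : ℕ} {Φ : B →+* PowerSeries (B ⊗[F] S)}
    {A : GL (Fin n) (cga 𝒜)} {Y Y' : GL (Fin n) B}
    (hY : GeneralLinearGroup.map Φ Y =
      GeneralLinearGroup.map (cgaSeries 𝒜 B) A * GeneralLinearGroup.map (constSeries S B) Y)
    (hY' : GeneralLinearGroup.map Φ Y' =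
      GeneralLinearGroup.map (cgaSeries 𝒜 B) A * GeneralLinearGroup.map (constSeries S B) Y') :
    GeneralLinearGroup.map Φ (Y⁻¹ * Y') = GeneralLinearGroup.map (constSeries S B) (Y⁻¹ * Y') := by
  simp only [map_mul, map_inv, hY, hY', _root_.mul_inv_rev]
  group

/-- The higher derivation of `R ⊗[F] R`. -/
def ThetaRing.tensorSeries (θR : ThetaRing θ R) :
    R ⊗[F] R →+* PowerSeries ((R ⊗[F] R) ⊗[F] S) :=
  tensorLift (θR.seriesAlong (Algebra.TensorProduct.includeLeft : R →ₐ[F] R ⊗[F] R))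
    (θR.seriesAlong (Algebra.TensorProduct.includeRight : R →ₐ[F] R ⊗[F] R)) (by
      ext1 x
      simp only [RingHom.comp_apply, θR.seriesAlong_algebraMap])

theorem ThetaRing.tensorSeries_tmul_one (θR : ThetaRing θ R) (r : R) :
    θR.tensorSeries (r ⊗ₜ 1) =
      θR.seriesAlong (Algebra.TensorProduct.includeLeft : R →ₐ[F] R ⊗[F] R) r := by
  rw [ThetaRing.tensorSeries, tensorLift_tmul, map_one, mul_one]

theorem ThetaRing.tensorSeries_one_tmul (θR : ThetaRing θ R) (r : R) :
    θR.tensorSeries (1 ⊗ₜ r) =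
      θR.seriesAlong (Algebra.TensorProduct.includeRight : R →ₐ[F] R ⊗[F] R) r := by
  rw [ThetaRing.tensorSeries, tensorLift_tmul, map_one, one_mul]

section BaseChange

variable (L : Type u) [CommRing L] [Algebra K L]

theorem HigherDerivation.series_algebraMap {R S : Type u} [CommRing R] [CommRing S] [Algebra R S]
    {K : Type u} [Field K] [Algebra K R] [Algebra K S] [IsScalarTower K R S]
    {𝒜 : ℕ → Submodule R S} [GradedAlgebra 𝒜] (θ : HigherDerivation K 𝒜) (c : K) :
    θ.series (algebraMap K R c) = PowerSeries.C (algebraMap R S (algebraMap K R c)) := by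
  have h : θ.toAlgHom (algebraMap K R c) = algebraMap K (cga 𝒜) c := θ.toAlgHom.commutes c
  have h' : ((algebraMap K (cga 𝒜) c : cga 𝒜) : PowerSeries S) =
      PowerSeries.C (algebraMap K S c) := PowerSeries.algebraMap_apply
  rw [← IsScalarTower.algebraMap_apply K R S, ← h', ← h]
  rfl

theorem ThetaRing.seriesAlong_algebraMap_const (θR : ThetaRing θ R) (g : R →ₐ[F] B) (c : K) :
    θR.seriesAlong g (algebraMap K R c) = constSeries S B (g (algebraMap K R c)) := by
  rw [ThetaRing.seriesAlong, RingHom.comp_apply, HigherDerivation.series_algebraMap,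
    PowerSeries.map_C]
  simp [constSeries, Algebra.TensorProduct.algebraMap_apply]

/-- The trivial extension of the higher derivation to `R ⊗[K] L`. -/
def ThetaRing.extSeries (θR : ThetaRing θ R) :
    R ⊗[K] L →+* PowerSeries ((R ⊗[K] L) ⊗[F] S) :=
  tensorLift (θR.seriesAlong (Algebra.TensorProduct.includeLeft : R →ₐ[F] R ⊗[K] L))
    ((constSeries S (R ⊗[K] L)).comp
      (Algebra.TensorProduct.includeRight : L →ₐ[K] R ⊗[K] L).toRingHom) (by
      ext1 x
      simp only [RingHom.comp_apply, θR.seriesAlong_algebraMap_const]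
      congr 1
      simp)

theorem ThetaRing.extSeries_tmul_one (θR : ThetaRing θ R) (r : R) :
    θR.extSeries L (r ⊗ₜ 1) =
      θR.seriesAlong (Algebra.TensorProduct.includeLeft : R →ₐ[F] R ⊗[K] L) r := by
  rw [ThetaRing.extSeries, tensorLift_tmul, map_one, mul_one]

theorem ThetaRing.extSeries_one_tmul (θR : ThetaRing θ R) (a : L) :
    θR.extSeries L (1 ⊗ₜ a) = constSeries S (R ⊗[K] L) (1 ⊗ₜ a) := by
  rw [ThetaRing.extSeries, tensorLift_tmul, map_one, one_mul]
  rfl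

theorem ThetaRing.extComp_tmul (θR : ThetaRing θ R) (k : ℕ) (r : R) (a : L) :
    θR.extComp L k (r ⊗ₜ a) = Algebra.TensorProduct.map
        (Algebra.TensorProduct.includeLeft : R →ₐ[F] R ⊗[K] L) (AlgHom.id F S)
        (θR.der.comp k r) * (((1 : R) ⊗ₜ[K] a) ⊗ₜ[F] (1 : S)) :=
  rfl

theorem ThetaRing.coeff_extSeries (θR : ThetaRing θ R) (k : ℕ) (x : R ⊗[K] L) :
    PowerSeries.coeff k (θR.extSeries L x) = θR.extComp L k x := by
  induction x using TensorProduct.induction_on with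
  | zero => simp
  | add x y hx hy => simp [hx, hy]
  | tmul r a =>
    rw [θR.extComp_tmul L, ThetaRing.extSeries, tensorLift_tmul, constSeries, RingHom.comp_apply,
      RingHom.comp_apply, PowerSeries.coeff_mul_C, θR.coeff_seriesAlong]
    rfl

/-- The functionals on `S` and on `L` act on different tensor factors, and the extended derivation
does not touch `L`. Hence the `L`-coordinates of a constant are constants of `R`. -/
theorem ThetaRing.contract_extComp (θR : ThetaRing θ R) (k : ℕ) (φ : S →ₗ[F] F) (ψ : L →ₗ[K] K)
    (x : R ⊗[K] L) : contract R ψ (contract (R ⊗[K] L) φ (θR.extComp L k x)) =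
      contract R φ (θR.der.comp k (contract R ψ x)) := by
  induction x using TensorProduct.induction_on with
  | zero => simp
  | add x y hx hy => simp [hx, hy]
  | tmul r a =>
    rw [θR.extComp_tmul L, contract_mul_tmul_one, contract_map, contract_tmul, map_smul,
      ← algebraMap_smul F (ψ a) (θR.der.comp k r),
      ← algebraMap_smul R (algebraMap K F (ψ a)) (θR.der.comp k r), map_smul, algebraMap_smul,
      algebraMap_smul]
    simp

/-- The constants of `R ⊗[K] L` are the elements of `L`. -/
theorem ThetaRing.mem_range_includeRight (θR : ThetaRing θ R)
    (hconst : θR.der.constants = Set.range (algebraMap K R)) {x : R ⊗[K] L}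
    (hx : θR.extSeries L x = constSeries S (R ⊗[K] L) x) :
    x ∈ (Algebra.TensorProduct.includeRight : L →ₐ[K] R ⊗[K] L).range := by
  have h : x ∈ Submodule.map₂ (TensorProduct.mk K R L)
      (LinearMap.range (Algebra.linearMap K R)) ⊤ := by
    refine mem_map₂_of_contract_mem (by simp) fun ψ => ?_
    have : contract R ψ x ∈ θR.der.constants := by
      refine θR.mem_constants_of_contract fun k hk φ => ?_
      rw [← θR.contract_extComp L, ← θR.coeff_extSeries L, ← contractCoeff_apply,
        contractCoeff_const hk φ hx, map_zero]
    rw [hconst] at this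
    exact this
  have hle : Submodule.map₂ (TensorProduct.mk K R L) (LinearMap.range (Algebra.linearMap K R)) ⊤ ≤
      Subalgebra.toSubmodule (Algebra.TensorProduct.includeRight : L →ₐ[K] R ⊗[K] L).range := by
    rw [Submodule.map₂_le]
    rintro _ ⟨c, rfl⟩ a -
    refine ⟨c • a, ?_⟩
    simp [Algebra.algebraMap_eq_smul_one]
  exact hle h

end BaseChange

end ThetaRing

open Matrix

/-! ### Homomorphisms determined by the fundamental matrix -/

section Generation

variable {F R : Type*} [CommRing F] [CommRing R] [Algebra F R] {n : ℕ} {Y : GL (Fin n) R}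

theorem range_le_of_map_eq
    (hgen : Algebra.adjoin F (Set.range (fun ij : Fin n × Fin n => Y.val ij.1 ij.2) ∪
      {((GeneralLinearGroup.det Y)⁻¹).val}) = ⊤)
    {B C : Type*} [CommRing B] [CommRing C] [Algebra F B] [Algebra F C] {f : R →ₐ[F] B}
    {h : C →ₐ[F] B} {W : GL (Fin n) C}
    (hW : GeneralLinearGroup.map (f : R →+* B) Y = GeneralLinearGroup.map (h : C →+* B) W) :
    f.range ≤ h.range := by
  rw [← Algebra.map_top, ← hgen, AlgHom.map_adjoin, Algebra.adjoin_le_iff]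
  rintro _ ⟨_, ⟨ij, rfl⟩ | rfl, rfl⟩
  · exact ⟨W.val ij.1 ij.2, (congrArg (fun M : GL (Fin n) B => M.val ij.1 ij.2) hW).symm⟩
  · refine ⟨((GeneralLinearGroup.det W)⁻¹).val, ?_⟩
    have := congrArg (fun M => ((GeneralLinearGroup.det M)⁻¹).val) hW
    simp only [GeneralLinearGroup.map_det, ← map_inv] at this
    exact this.symm

/-- Agreement on `F` is a separate hypothesis because the lemma is applied to maps into power series
that act on `F` through `θ`. -/
theorem ringHom_ext_of_map_eq
    (hgen : Algebra.adjoin F (Set.range (fun ij : Fin n × Fin n => Y.val ij.1 ij.2) ∪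
      {((GeneralLinearGroup.det Y)⁻¹).val}) = ⊤)
    {B : Type*} [CommRing B] {f g : R →+* B}
    (hF : f.comp (algebraMap F R) = g.comp (algebraMap F R))
    (hY : GeneralLinearGroup.map f Y = GeneralLinearGroup.map g Y) : f = g := by
  ext r
  have hr : r ∈ Algebra.adjoin F (Set.range (fun ij : Fin n × Fin n => Y.val ij.1 ij.2) ∪
      {((GeneralLinearGroup.det Y)⁻¹).val}) := hgen ▸ Algebra.mem_top
  induction hr using Algebra.adjoin_induction with
  | mem x hx =>
    rcases hx with ⟨ij, rfl⟩ | rfl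
    · exact congrArg (fun M : GL (Fin n) B => M.val ij.1 ij.2) hY
    · have := congrArg (fun M => ((GeneralLinearGroup.det M)⁻¹).val) hY
      simp only [GeneralLinearGroup.map_det, ← map_inv] at this
      exact this
  | algebraMap r => exact RingHom.congr_fun hF r
  | add x y _ _ hx hy => rw [map_add, map_add, hx, hy]
  | mul x y _ _ hx hy => rw [map_mul, map_mul, hx, hy]

theorem tensorProduct_ringHom_ext {k A B C : Type*} [CommRing k] [CommRing A] [CommRing B]
    [CommRing C] [Algebra k A] [Algebra k B] {f g : A ⊗[k] B →+* C}
    (hA : ∀ a : A, f (a ⊗ₜ 1) = g (a ⊗ₜ 1)) (hB : ∀ b : B, f (1 ⊗ₜ b) = g (1 ⊗ₜ b)) : f = g := by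
  refine RingHom.ext fun x => ?_
  induction x using TensorProduct.induction_on with
  | zero => simp
  | add x y hx hy => simp [hx, hy]
  | tmul a b =>
    rw [← mul_one a, ← one_mul b, ← Algebra.TensorProduct.tmul_mul_tmul, map_mul, map_mul, hA, hB]

end Generation

/-! ### The coordinate ring of the Galois group scheme -/

section GaloisAlgebra

variable {K F R : Type u} [Field K] [CommRing F] [CommRing R] [Algebra F R] {n : ℕ}

variable (F) in
/-- The matrix `(Y ⊗ 1)⁻¹ (1 ⊗ Y)`. -/
def galoisMatrix (Y : GL (Fin n) R) :
    GL (Fin n) (R ⊗[F] R) :=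
  (GeneralLinearGroup.map
      ((Algebra.TensorProduct.includeLeft : R →ₐ[F] R ⊗[F] R) : R →+* R ⊗[F] R) Y)⁻¹ *
    GeneralLinearGroup.map
      ((Algebra.TensorProduct.includeRight : R →ₐ[F] R ⊗[F] R) : R →+* R ⊗[F] R) Y

variable (K) [Algebra K F] [Algebra K R] [IsScalarTower K F R]

variable (F) in
/-- The subalgebra of `R ⊗[F] R` generated over `K` by the entries of `galoisMatrix F Y` and of its
inverse. -/
def galoisAlgebra (Y : GL (Fin n) R) : Subalgebra K (R ⊗[F] R) :=
  Algebra.adjoin K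
    (Set.range (fun ij : Fin n × Fin n => (galoisMatrix F Y).val ij.1 ij.2) ∪
      Set.range (fun ij : Fin n × Fin n => ((galoisMatrix F Y)⁻¹).val ij.1 ij.2))

theorem galoisAlgebra_le_iff {Y : GL (Fin n) R} {V : Subalgebra K (R ⊗[F] R)} :
    galoisAlgebra K F Y ≤ V ↔ (∀ i j, (galoisMatrix F Y).val i j ∈ V) ∧
      ∀ i j, ((galoisMatrix F Y)⁻¹).val i j ∈ V := by
  rw [galoisAlgebra, Algebra.adjoin_le_iff, Set.union_subset_iff, Set.range_subset_iff,
    Set.range_subset_iff, Prod.forall, Prod.forall]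
  rfl

theorem galoisMatrix_mem (Y : GL (Fin n) R) (i j : Fin n) :
    (galoisMatrix F Y).val i j ∈ galoisAlgebra K F Y :=
  ((galoisAlgebra_le_iff K).1 le_rfl).1 i j

theorem galoisMatrix_inv_mem (Y : GL (Fin n) R) (i j : Fin n) :
    ((galoisMatrix F Y)⁻¹).val i j ∈ galoisAlgebra K F Y :=
  ((galoisAlgebra_le_iff K).1 le_rfl).2 i j

instance finiteType_galoisAlgebra (Y : GL (Fin n) R) :
    Algebra.FiniteType K (galoisAlgebra K F Y) := by
  rw [← Subalgebra.fg_iff_finiteType]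
  exact Subalgebra.fg_def.2 ⟨_, (Set.finite_range _).union (Set.finite_range _), rfl⟩

variable (F) in
/-- `galoisMatrix F Y` with entries in `galoisAlgebra K F Y`. -/
def genericMatrix (Y : GL (Fin n) R) : GL (Fin n) (galoisAlgebra K F Y) where
  val := Matrix.of fun i j => ⟨_, galoisMatrix_mem K Y i j⟩
  inv := Matrix.of fun i j => ⟨_, galoisMatrix_inv_mem K Y i j⟩
  val_inv := by
    apply Matrix.map_injective (f := (galoisAlgebra K F Y).val) Subtype.val_injective
    exact Matrix.map_mul.trans (((galoisMatrix F Y).val_inv).trans (by simp))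
  inv_val := by
    apply Matrix.map_injective (f := (galoisAlgebra K F Y).val) Subtype.val_injective
    exact Matrix.map_mul.trans (((galoisMatrix F Y).inv_val).trans (by simp))

theorem galoisAlgebra_hom_ext {Y : GL (Fin n) R} {B : Type*} [CommRing B] [Algebra K B]
    {f g : galoisAlgebra K F Y →ₐ[K] B}
    (h : GeneralLinearGroup.map (f : galoisAlgebra K F Y →+* B) (genericMatrix K F Y) =
      GeneralLinearGroup.map (g : galoisAlgebra K F Y →+* B) (genericMatrix K F Y)) : f = g := by
  have key : galoisAlgebra K F Y ≤ (AlgHom.equalizer f g).map (galoisAlgebra K F Y).val := by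
    rw [galoisAlgebra_le_iff]
    refine ⟨fun i j => ⟨(genericMatrix K F Y).val i j, ?_, rfl⟩,
      fun i j => ⟨((genericMatrix K F Y)⁻¹).val i j, ?_, rfl⟩⟩
    · exact congrArg (fun M : GL (Fin n) B => M.val i j) h
    · have := congrArg (fun M : GL (Fin n) B => (M⁻¹).val i j) h
      simp only [← map_inv] at this
      exact this
  ext u
  obtain ⟨v, hv, hvu⟩ := key u.2
  obtain rfl : v = u := Subtype.ext hvu
  exact hv

/-- The antipode of `galoisAlgebra K F Y`, induced by the swap of the factors of `R ⊗[F] R`. -/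
theorem exists_antipode (Y : GL (Fin n) R) :
    ∃ ι : galoisAlgebra K F Y →ₐ[K] galoisAlgebra K F Y,
      GeneralLinearGroup.map (ι : galoisAlgebra K F Y →+* galoisAlgebra K F Y)
        (genericMatrix K F Y) = (genericMatrix K F Y)⁻¹ := by
  let c : R ⊗[F] R →ₐ[K] R ⊗[F] R :=
    (Algebra.TensorProduct.comm F R R : R ⊗[F] R →ₐ[F] R ⊗[F] R).restrictScalars K
  -- The swap exchanges `Y ⊗ 1` and `1 ⊗ Y`, so it inverts the Galois matrix.
  have hc : GeneralLinearGroup.map (c : R ⊗[F] R →+* R ⊗[F] R) (galoisMatrix F Y) =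
      (galoisMatrix F Y)⁻¹ := by
    rw [galoisMatrix, map_mul, map_inv, _root_.mul_inv_rev, inv_inv]
    rfl
  have hc' : GeneralLinearGroup.map (c : R ⊗[F] R →+* R ⊗[F] R) (galoisMatrix F Y)⁻¹ =
      galoisMatrix F Y := by
    rw [map_inv, hc, inv_inv]
  have hle : galoisAlgebra K F Y ≤ (galoisAlgebra K F Y).comap c := by
    rw [galoisAlgebra_le_iff]
    refine ⟨fun i j => ?_, fun i j => ?_⟩
    · have := congrArg (fun M : GL (Fin n) (R ⊗[F] R) => M.val i j) hc
      rw [Subalgebra.mem_comap]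
      exact Set.mem_of_eq_of_mem this (galoisMatrix_inv_mem K Y i j)
    · have := congrArg (fun M : GL (Fin n) (R ⊗[F] R) => M.val i j) hc'
      rw [Subalgebra.mem_comap]
      exact Set.mem_of_eq_of_mem this (galoisMatrix_mem K Y i j)
  refine ⟨(c.comp (galoisAlgebra K F Y).val).codRestrict _ fun u => hle u.2, ?_⟩
  ext i j
  exact congrArg (fun M : GL (Fin n) (R ⊗[F] R) => M.val i j) hc

end GaloisAlgebra

section ThetaRing

variable {K F S : Type u} [Field K] [Field F] [CommRing S] [Algebra K F] [Algebra F S]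
  [Algebra K S] [IsScalarTower K F S] {𝒜 : ℕ → Submodule F S} [GradedAlgebra 𝒜]
  {θ : HigherDerivation K 𝒜} {R : Type u} [CommRing R] [Algebra F R]
  [Algebra K R] [IsScalarTower K F R] {n : ℕ} {A : GL (Fin n) (cga 𝒜)} {Y : GL (Fin n) R}

/-! ### The torsor map and the coaction -/

section Torsor

theorem ThetaRing.IsFundamentalMatrix.map_tensorSeries {θR : ThetaRing θ R}
    (hY : θR.IsFundamentalMatrix A Y) :
    GeneralLinearGroup.map θR.tensorSeries (galoisMatrix F Y) =
      GeneralLinearGroup.map (constSeries S (R ⊗[F] R)) (galoisMatrix F Y) := by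
  refine map_inv_mul_eq_const (A := A) ?_ ?_
  · rw [← hY.map_seriesAlong]
    ext i j : 2
    exact θR.tensorSeries_tmul_one _
  · rw [← hY.map_seriesAlong]
    ext i j : 2
    exact θR.tensorSeries_one_tmul _

theorem ThetaRing.IsFundamentalMatrix.tensorSeries_eq_const {θR : ThetaRing θ R}
    (hY : θR.IsFundamentalMatrix A Y) (u : galoisAlgebra K F Y) :
    θR.tensorSeries u = constSeries S (R ⊗[F] R) u := by
  have h := hY.map_tensorSeries
  have h' := congrArg (·⁻¹) h
  simp only [← map_inv] at h'
  -- The constants form a `K`-subalgebra, so only the generators need checking.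
  have key : galoisAlgebra K F Y ≤
      { RingHom.eqLocus θR.tensorSeries (constSeries S (R ⊗[F] R)) with
        algebraMap_mem' := fun c => by
          change θR.tensorSeries (algebraMap K R c ⊗ₜ 1) = _
          rw [θR.tensorSeries_tmul_one, θR.seriesAlong_algebraMap_const]
          rfl } := by
    rw [galoisAlgebra_le_iff]
    exact ⟨fun i j => congrArg (fun M : GL (Fin n) _ => M.val i j) h,
      fun i j => congrArg (fun M : GL (Fin n) _ => M.val i j) h'⟩
  exact key u.2

/-- The multiplication `R ⊗[K] U → R ⊗[F] R`. -/
def torsorMap (K : Type u) [Field K] [Algebra K F] [Algebra K R] [IsScalarTower K F R]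
    (Y : GL (Fin n) R) : R ⊗[K] galoisAlgebra K F Y →ₐ[R] R ⊗[F] R :=
  Algebra.TensorProduct.lift (Algebra.TensorProduct.includeLeft : R →ₐ[R] R ⊗[F] R)
    (galoisAlgebra K F Y).val fun _ _ => Commute.all _ _

/-- A `K`-basis of the Galois algebra consists of constants of `R ⊗[F] R`, so it stays independent
over `R`. -/
theorem torsorMap_injective {θR : ThetaRing θ R} (hsimple : θR.IsSimple)
    (hconst : θR.der.constants = Set.range (algebraMap K R)) (hY : θR.IsFundamentalMatrix A Y) :
    Function.Injective (torsorMap (F := F) K Y) := by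
  let b := Module.Basis.ofVectorSpace K (galoisAlgebra K F Y)
  have hli : LinearIndependent R fun i => (b i : R ⊗[F] R) := by
    refine θR.linearIndependent_of_constants hsimple hconst (Φ := θR.tensorSeries)
      (fun r => θR.tensorSeries_tmul_one r) (fun i => hY.tensorSeries_eq_const (b i)) ?_
    exact b.linearIndependent.map' (galoisAlgebra K F Y).val.toLinearMap
      (LinearMap.ker_eq_bot.2 Subtype.val_injective)
  have h : ∀ x, torsorMap (F := F) K Y x =
      Finsupp.linearCombination R (fun i => (b i : R ⊗[F] R)) ((b.baseChange R).repr x) := by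
    intro x
    conv_lhs => rw [← (b.baseChange R).linearCombination_repr x]
    rw [← AlgHom.toLinearMap_apply, Finsupp.apply_linearCombination]
    congr 2
    ext i
    rw [Function.comp_apply, Module.Basis.baseChange_apply]
    exact one_mul _
  intro x y hxy
  rw [h, h] at hxy
  exact (b.baseChange R).repr.injective (hli hxy)

theorem map_torsorMap (Y : GL (Fin n) R) :
    GeneralLinearGroup.map
      (torsorMap (F := F) K Y : R ⊗[K] galoisAlgebra K F Y →+* R ⊗[F] R)
      (GeneralLinearGroup.map
        ((Algebra.TensorProduct.includeLeft : R →ₐ[F] R ⊗[K] galoisAlgebra K F Y) : R →+* _) Y *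
      GeneralLinearGroup.map ((Algebra.TensorProduct.includeRight :
        galoisAlgebra K F Y →ₐ[K] R ⊗[K] galoisAlgebra K F Y) : galoisAlgebra K F Y →+* _)
        (genericMatrix K F Y)) =
    GeneralLinearGroup.map
      ((Algebra.TensorProduct.includeRight : R →ₐ[F] R ⊗[F] R) : R →+* R ⊗[F] R) Y := by
  have h1 : GeneralLinearGroup.map
      (torsorMap (F := F) K Y : R ⊗[K] galoisAlgebra K F Y →+* R ⊗[F] R)
      (GeneralLinearGroup.map ((Algebra.TensorProduct.includeRight :
        galoisAlgebra K F Y →ₐ[K] R ⊗[K] galoisAlgebra K F Y) : galoisAlgebra K F Y →+* _)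
        (genericMatrix K F Y)) = galoisMatrix F Y := by
    ext i j
    exact one_mul _
  have h2 : GeneralLinearGroup.map
      (torsorMap (F := F) K Y : R ⊗[K] galoisAlgebra K F Y →+* R ⊗[F] R)
      (GeneralLinearGroup.map
        ((Algebra.TensorProduct.includeLeft : R →ₐ[F] R ⊗[K] galoisAlgebra K F Y) : R →+* _) Y) =
      GeneralLinearGroup.map
      ((Algebra.TensorProduct.includeLeft : R →ₐ[F] R ⊗[F] R) : R →+* R ⊗[F] R) Y := by
    ext i j
    exact mul_one _
  rw [map_mul, h1, h2, galoisMatrix, mul_inv_cancel_left]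

/-- The coaction `Y ↦ Y ⊗ Z` of the Galois group scheme on `R`. -/
theorem exists_coaction {θR : ThetaRing θ R} (hsimple : θR.IsSimple)
    (hconst : θR.der.constants = Set.range (algebraMap K R)) (hY : θR.IsFundamentalMatrix A Y)
    (hgen : Algebra.adjoin F (Set.range (fun ij : Fin n × Fin n => Y.val ij.1 ij.2) ∪
      {((GeneralLinearGroup.det Y)⁻¹).val}) = ⊤) :
    ∃ ρ : R →ₐ[F] R ⊗[K] galoisAlgebra K F Y,
      GeneralLinearGroup.map (ρ : R →+* R ⊗[K] galoisAlgebra K F Y) Y =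
        GeneralLinearGroup.map
          ((Algebra.TensorProduct.includeLeft : R →ₐ[F] R ⊗[K] galoisAlgebra K F Y) : R →+* _) Y *
        GeneralLinearGroup.map ((Algebra.TensorProduct.includeRight :
          galoisAlgebra K F Y →ₐ[K] R ⊗[K] galoisAlgebra K F Y) : galoisAlgebra K F Y →+* _)
          (genericMatrix K F Y) := by
  let e := (torsorMap (F := F) K Y).restrictScalars F
  have hinj : Function.Injective e := torsorMap_injective hsimple hconst hY
  have hle : (Algebra.TensorProduct.includeRight : R →ₐ[F] R ⊗[F] R).range ≤ e.range :=
    range_le_of_map_eq hgen (map_torsorMap (F := F) (K := K) Y).symm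
  -- The coaction is `r ↦ 1 ⊗ r`, pulled back along the injective torsor map.
  let ρ : R →ₐ[F] R ⊗[K] galoisAlgebra K F Y :=
    (AlgEquiv.ofInjective e hinj).symm.toAlgHom.comp
      ((Algebra.TensorProduct.includeRight : R →ₐ[F] R ⊗[F] R).codRestrict e.range
        fun r => hle ⟨r, rfl⟩)
  have hρ : ∀ r, e (ρ r) = 1 ⊗ₜ r := fun r =>
    congrArg Subtype.val ((AlgEquiv.ofInjective e hinj).apply_symm_apply _)
  refine ⟨ρ, ?_⟩
  ext i j
  apply hinj
  have := congrArg (fun M : GL (Fin n) (R ⊗[F] R) => M.val i j)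
    (map_torsorMap (F := F) (K := K) Y)
  exact (hρ _).trans this.symm

end Torsor

end ThetaRing

/-! ### Endomorphisms of `R ⊗[K] L` attached to points -/

section Translation

variable {K F R : Type u} [Field K] [CommRing F] [CommRing R] [Algebra K F] [Algebra F R]
  [Algebra K R] [IsScalarTower K F R] {n : ℕ} {Y : GL (Fin n) R} {U : Type u} [CommRing U]
  [Algebra K U]

/-- The `U`-point `C` of `GL_n`, as an `R ⊗ U`-point. -/
abbrev rightGL (K R : Type u) {U : Type u} [Field K] [CommRing R] [Algebra K R] [CommRing U]
    [Algebra K U] (C : GL (Fin n) U) : GL (Fin n) (R ⊗[K] U) :=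
  GeneralLinearGroup.map
    ((Algebra.TensorProduct.includeRight : U →ₐ[K] R ⊗[K] U) : U →+* R ⊗[K] U) C

/-- The `R`-point `Y` of `GL_n`, as an `R ⊗ U`-point. -/
abbrev leftGL (K U : Type u) {R : Type u} [Field K] [CommRing R] [Algebra K R] [CommRing U]
    [Algebra K U] (Y : GL (Fin n) R) : GL (Fin n) (R ⊗[K] U) :=
  GeneralLinearGroup.map
    ((Algebra.TensorProduct.includeLeft : R →ₐ[K] R ⊗[K] U) : R →+* R ⊗[K] U) Y

variable {L L' : Type u} [CommRing L] [Algebra K L] [CommRing L'] [Algebra K L']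

/-- The `L`-linear endomorphism of `R ⊗ L` given by a coaction `ρ` and an `L`-point `g`. -/
def translation (ρ : R →ₐ[F] R ⊗[K] U) (g : U →ₐ[K] L) : R ⊗[K] L →ₐ[F] R ⊗[K] L :=
  Algebra.TensorProduct.lift ((Algebra.TensorProduct.map (AlgHom.id F R) g).comp ρ)
    (Algebra.TensorProduct.includeRight : L →ₐ[K] R ⊗[K] L) fun _ _ => Commute.all _ _

theorem translation_tmul_one (ρ : R →ₐ[F] R ⊗[K] U) (g : U →ₐ[K] L) (r : R) :
    translation ρ g (r ⊗ₜ 1) = Algebra.TensorProduct.map (AlgHom.id F R) g (ρ r) := by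
  simp [translation, ← Algebra.TensorProduct.one_def]

theorem translation_one_tmul (ρ : R →ₐ[F] R ⊗[K] U) (g : U →ₐ[K] L) (a : L) :
    translation ρ g (1 ⊗ₜ a) = 1 ⊗ₜ a := by
  simp [translation]

theorem map_translation_rightGL (ρ : R →ₐ[F] R ⊗[K] U) (g : U →ₐ[K] L) (C : GL (Fin n) L) :
    GeneralLinearGroup.map (translation ρ g : R ⊗[K] L →+* R ⊗[K] L) (rightGL K R C) =
      rightGL K R C := by
  ext i j
  exact translation_one_tmul ρ g _

theorem map_translation_leftGL {ρ : R →ₐ[F] R ⊗[K] U} {Z : GL (Fin n) U}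
    (hρ : GeneralLinearGroup.map (ρ : R →+* R ⊗[K] U) Y = leftGL K U Y * rightGL K R Z)
    (g : U →ₐ[K] L) :
    GeneralLinearGroup.map (translation ρ g : R ⊗[K] L →+* R ⊗[K] L) (leftGL K L Y) =
      leftGL K L Y * rightGL K R (GeneralLinearGroup.map (g : U →+* L) Z) := by
  have h := congrArg (GeneralLinearGroup.map
    (Algebra.TensorProduct.map (AlgHom.id F R) g : R ⊗[K] U →+* R ⊗[K] L)) hρ
  rw [map_mul] at h
  have h1 : GeneralLinearGroup.map (Algebra.TensorProduct.map (AlgHom.id F R) g :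
      R ⊗[K] U →+* R ⊗[K] L) (leftGL K U Y) = leftGL K L Y := by
    ext i j
    simp
  have h2 : GeneralLinearGroup.map (Algebra.TensorProduct.map (AlgHom.id F R) g :
      R ⊗[K] U →+* R ⊗[K] L) (rightGL K R Z) =
      rightGL K R (GeneralLinearGroup.map (g : U →+* L) Z) := by
    ext i j
    simp
  rw [h1, h2] at h
  rw [← h]
  ext i j
  exact translation_tmul_one ρ g _

theorem algHom_ext_of_map_leftGL
    (hgen : Algebra.adjoin F (Set.range (fun ij : Fin n × Fin n => Y.val ij.1 ij.2) ∪
      {((GeneralLinearGroup.det Y)⁻¹).val}) = ⊤)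
    {B : Type*} [CommRing B] [Algebra F B] {f g : R ⊗[K] L →ₐ[F] B}
    (hL : ∀ a : L, f (1 ⊗ₜ a) = g (1 ⊗ₜ a))
    (hY : GeneralLinearGroup.map (f : R ⊗[K] L →+* B) (leftGL K L Y) =
      GeneralLinearGroup.map (g : R ⊗[K] L →+* B) (leftGL K L Y)) : f = g := by
  have h : (f : R ⊗[K] L →+* B).comp
      ((Algebra.TensorProduct.includeLeft : R →ₐ[F] R ⊗[K] L) : R →+* R ⊗[K] L) =
      (g : R ⊗[K] L →+* B).comp
      ((Algebra.TensorProduct.includeLeft : R →ₐ[F] R ⊗[K] L) : R →+* R ⊗[K] L) := by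
    refine ringHom_ext_of_map_eq hgen ?_ hY
    ext x
    exact (f.commutes x).trans (g.commutes x).symm
  have := tensorProduct_ringHom_ext (f := (f : R ⊗[K] L →+* B)) (g := (g : R ⊗[K] L →+* B))
    (fun r => RingHom.congr_fun h r) hL
  exact AlgHom.ext fun x => RingHom.congr_fun this x

/-- Translations fix matrices over `L`, so the composite sends `Y` to `Y · g'(Z) · g(Z)`, and `Y`
together with `L` determines it. -/
theorem translation_comp_translation
    (hgen : Algebra.adjoin F (Set.range (fun ij : Fin n × Fin n => Y.val ij.1 ij.2) ∪
      {((GeneralLinearGroup.det Y)⁻¹).val}) = ⊤)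
    {ρ : R →ₐ[F] R ⊗[K] U} {Z : GL (Fin n) U}
    (hρ : GeneralLinearGroup.map (ρ : R →+* R ⊗[K] U) Y = leftGL K U Y * rightGL K R Z)
    {g g' : U →ₐ[K] L} (h : GeneralLinearGroup.map (g' : U →+* L) Z *
      GeneralLinearGroup.map (g : U →+* L) Z = 1) :
    (translation ρ g').comp (translation ρ g) = AlgHom.id F (R ⊗[K] L) := by
  refine algHom_ext_of_map_leftGL hgen (fun a => ?_) ?_
  · simp [translation_one_tmul]
  · have : GeneralLinearGroup.map ((translation ρ g').comp (translation ρ g) :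
        R ⊗[K] L →+* R ⊗[K] L) (leftGL K L Y) =
        GeneralLinearGroup.map (translation ρ g' : R ⊗[K] L →+* R ⊗[K] L)
        (GeneralLinearGroup.map (translation ρ g : R ⊗[K] L →+* R ⊗[K] L) (leftGL K L Y)) := rfl
    rw [this, map_translation_leftGL hρ, map_mul, map_translation_leftGL hρ,
      map_translation_rightGL, mul_assoc, ← map_mul, h, map_one, mul_one]
    rfl

theorem translation_comp_map (ρ : R →ₐ[F] R ⊗[K] U) (g : U →ₐ[K] L) (f : L →ₐ[K] L')
    (x : R ⊗[K] L) :
    translation ρ (f.comp g) (Algebra.TensorProduct.map (AlgHom.id K R) f x) =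
      Algebra.TensorProduct.map (AlgHom.id K R) f (translation ρ g x) := by
  have hcomp : ∀ y : R ⊗[K] U, Algebra.TensorProduct.map (AlgHom.id F R) (f.comp g) y =
      Algebra.TensorProduct.map (AlgHom.id K R) f
        (Algebra.TensorProduct.map (AlgHom.id F R) g y) := by
    intro y
    induction y using TensorProduct.induction_on with
    | zero => simp
    | add x y hx hy => simp [hx, hy]
    | tmul r a => simp
  have := tensorProduct_ringHom_ext
    (f := (translation ρ (f.comp g) : R ⊗[K] L' →+* R ⊗[K] L').comp
      (Algebra.TensorProduct.map (AlgHom.id K R) f : R ⊗[K] L →+* R ⊗[K] L'))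
    (g := (Algebra.TensorProduct.map (AlgHom.id K R) f : R ⊗[K] L →+* R ⊗[K] L').comp
      (translation ρ g : R ⊗[K] L →+* R ⊗[K] L))
    (fun r => by simp [translation_tmul_one, hcomp]) (fun a => by simp [translation_one_tmul])
  exact RingHom.congr_fun this x

end Translation

/-! ### Automorphisms correspond to points of the Galois algebra -/

section ThetaRing

variable {K F S : Type u} [Field K] [Field F] [CommRing S] [Algebra K F] [Algebra F S]
  {𝒜 : ℕ → Submodule F S} [GradedAlgebra 𝒜] {R : Type u} [CommRing R] [Algebra F R]
  [Algebra K R] [IsScalarTower K F R] {L : Type u} [CommRing L] [Algebra K L]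

/-- The map induced by an endomorphism on power series over `R_L ⊗ S`. -/
def mapSeries (S : Type u) [CommRing S] [Algebra F S] (σ : R ⊗[K] L →ₐ[F] R ⊗[K] L) :
    PowerSeries ((R ⊗[K] L) ⊗[F] S) →+* PowerSeries ((R ⊗[K] L) ⊗[F] S) :=
  PowerSeries.map (Algebra.TensorProduct.map σ (AlgHom.id F S)).toRingHom

theorem mapSeries_constSeries (σ : R ⊗[K] L →ₐ[F] R ⊗[K] L) (x : R ⊗[K] L) :
    mapSeries S σ (constSeries S _ x) = constSeries S _ (σ x) := by
  simp [mapSeries, constSeries]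

theorem mapSeries_cgaSeries (σ : R ⊗[K] L →ₐ[F] R ⊗[K] L) (a : cga 𝒜) :
    mapSeries S σ (cgaSeries 𝒜 _ a) = cgaSeries 𝒜 _ a := by
  ext k
  simp [mapSeries, coeff_cgaSeries]

theorem map_mapSeries_map_constSeries {n : ℕ} (σ : R ⊗[K] L →ₐ[F] R ⊗[K] L)
    (C : GL (Fin n) (R ⊗[K] L)) :
    GeneralLinearGroup.map (mapSeries S σ) (GeneralLinearGroup.map (constSeries S _) C) =
      GeneralLinearGroup.map (constSeries S _)
        (GeneralLinearGroup.map (σ : R ⊗[K] L →+* R ⊗[K] L) C) := by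
  ext i j : 2
  exact mapSeries_constSeries σ _

theorem map_mapSeries_map_cgaSeries {n : ℕ} (σ : R ⊗[K] L →ₐ[F] R ⊗[K] L)
    (A : GL (Fin n) (cga 𝒜)) :
    GeneralLinearGroup.map (mapSeries S σ) (GeneralLinearGroup.map (cgaSeries 𝒜 _) A) =
      GeneralLinearGroup.map (cgaSeries 𝒜 _) A := by
  ext i j : 2
  exact mapSeries_cgaSeries σ _

variable [Algebra K S] [IsScalarTower K F S] {θ : HigherDerivation K 𝒜} {n : ℕ}
  {A : GL (Fin n) (cga 𝒜)} {Y : GL (Fin n) R}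

/-- As an equality of ring homomorphisms, the degreewise condition can be checked on generators. -/
theorem ThetaRing.commutes_iff (θR : ThetaRing θ R) (σ : R ⊗[K] L →ₐ[F] R ⊗[K] L) :
    (∀ (k : ℕ) (x : R ⊗[K] L), θR.extComp L k (σ x) =
      Algebra.TensorProduct.map σ (AlgHom.id F S) (θR.extComp L k x)) ↔
    (θR.extSeries L).comp (σ : R ⊗[K] L →+* R ⊗[K] L) =
      (mapSeries S σ).comp (θR.extSeries L) := by
  constructor
  · intro h
    refine RingHom.ext fun x => PowerSeries.ext fun k => ?_
    simp only [RingHom.comp_apply, mapSeries, PowerSeries.coeff_map]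
    exact (θR.coeff_extSeries L k _).trans ((h k x).trans
      (congrArg _ (θR.coeff_extSeries L k x).symm))
  · intro h k x
    have := congrArg (PowerSeries.coeff k) (RingHom.congr_fun h x)
    simp only [RingHom.comp_apply, mapSeries, PowerSeries.coeff_map, θR.coeff_extSeries L] at this
    exact this

theorem ThetaRing.IsFundamentalMatrix.map_extSeries {θR : ThetaRing θ R}
    (hY : θR.IsFundamentalMatrix A Y) :
    GeneralLinearGroup.map (θR.extSeries L) (leftGL K L Y) =
      GeneralLinearGroup.map (cgaSeries 𝒜 (R ⊗[K] L)) A *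
        GeneralLinearGroup.map (constSeries S (R ⊗[K] L)) (leftGL K L Y) := by
  have := hY.map_seriesAlong (Algebra.TensorProduct.includeLeft : R →ₐ[F] R ⊗[K] L)
  refine Eq.trans ?_ this
  ext i j : 2
  exact θR.extSeries_tmul_one L _

theorem ThetaRing.map_extSeries_rightGL (θR : ThetaRing θ R) (C : GL (Fin n) L) :
    GeneralLinearGroup.map (θR.extSeries L) (rightGL K R C) =
      GeneralLinearGroup.map (constSeries S (R ⊗[K] L)) (rightGL K R C) := by
  ext i j : 2
  exact θR.extSeries_one_tmul L _

/-- An `L`-linear endomorphism commutes with the higher derivation if it multiplies a fundamental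
matrix by a matrix with entries in `L`. -/
theorem ThetaRing.IsFundamentalMatrix.commutes {θR : ThetaRing θ R}
    (hY : θR.IsFundamentalMatrix A Y)
    (hgen : Algebra.adjoin F (Set.range (fun ij : Fin n × Fin n => Y.val ij.1 ij.2) ∪
      {((GeneralLinearGroup.det Y)⁻¹).val}) = ⊤)
    {σ : R ⊗[K] L →ₐ[F] R ⊗[K] L} (hσL : ∀ a : L, σ (1 ⊗ₜ a) = 1 ⊗ₜ a) {C : GL (Fin n) L}
    (hσ : GeneralLinearGroup.map (σ : R ⊗[K] L →+* R ⊗[K] L) (leftGL K L Y) =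
      leftGL K L Y * rightGL K R C) (k : ℕ) (x : R ⊗[K] L) :
    θR.extComp L k (σ x) =
      Algebra.TensorProduct.map σ (AlgHom.id F S) (θR.extComp L k x) := by
  revert k x
  rw [θR.commutes_iff]
  refine tensorProduct_ringHom_ext (fun r => ?_) fun a => ?_
  · refine RingHom.congr_fun (f := ((θR.extSeries L).comp (σ : R ⊗[K] L →+* R ⊗[K] L)).comp
      (Algebra.TensorProduct.includeLeft : R →ₐ[F] R ⊗[K] L).toRingHom)
      (g := ((mapSeries S σ).comp (θR.extSeries L)).comp
      (Algebra.TensorProduct.includeLeft : R →ₐ[F] R ⊗[K] L).toRingHom) ?_ r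
    refine ringHom_ext_of_map_eq hgen ?_ ?_
    · ext1 x
      have hx : σ (algebraMap F R x ⊗ₜ 1) = algebraMap F R x ⊗ₜ 1 := σ.commutes x
      change θR.extSeries L (σ (algebraMap F R x ⊗ₜ 1)) =
        mapSeries S σ (θR.extSeries L (algebraMap F R x ⊗ₜ 1))
      rw [hx, θR.extSeries_tmul_one L, θR.seriesAlong_algebraMap]
      ext k
      simp [mapSeries]
    · change GeneralLinearGroup.map (θR.extSeries L)
          (GeneralLinearGroup.map (σ : R ⊗[K] L →+* R ⊗[K] L) (leftGL K L Y)) =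
        GeneralLinearGroup.map (mapSeries S σ)
          (GeneralLinearGroup.map (θR.extSeries L) (leftGL K L Y))
      rw [hY.map_extSeries, map_mul, map_mapSeries_map_cgaSeries, map_mapSeries_map_constSeries,
        hσ, map_mul, hY.map_extSeries, θR.map_extSeries_rightGL, map_mul, mul_assoc]
  · change θR.extSeries L (σ (1 ⊗ₜ a)) = mapSeries S σ (θR.extSeries L (1 ⊗ₜ a))
    rw [hσL, θR.extSeries_one_tmul L, mapSeries_constSeries, hσL]

/-- An automorphism in the Galois group multiplies a fundamental matrix by a constant matrix. -/
theorem ThetaRing.IsFundamentalMatrix.map_extSeries_autGroup {θR : ThetaRing θ R}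
    (hY : θR.IsFundamentalMatrix A Y) (σ : θR.autGroup L) :
    GeneralLinearGroup.map (θR.extSeries L) (GeneralLinearGroup.map
      ((σ.val : R ⊗[K] L →ₐ[F] R ⊗[K] L) : R ⊗[K] L →+* R ⊗[K] L) (leftGL K L Y)) =
      GeneralLinearGroup.map (cgaSeries 𝒜 (R ⊗[K] L)) A *
        GeneralLinearGroup.map (constSeries S (R ⊗[K] L)) (GeneralLinearGroup.map
      ((σ.val : R ⊗[K] L →ₐ[F] R ⊗[K] L) : R ⊗[K] L →+* R ⊗[K] L) (leftGL K L Y)) := by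
  have h := (θR.commutes_iff (σ.val : R ⊗[K] L →ₐ[F] R ⊗[K] L)).1 σ.2.2
  have h' := congrArg (fun f => GeneralLinearGroup.map f (leftGL K L Y)) h
  refine Eq.trans h' ?_
  change GeneralLinearGroup.map (mapSeries S _)
    (GeneralLinearGroup.map (θR.extSeries L) (leftGL K L Y)) = _
  rw [hY.map_extSeries, map_mul, map_mapSeries_map_cgaSeries, map_mapSeries_map_constSeries]

/-- Every automorphism comes from a point of the Galois algebra. -/
theorem ThetaRing.IsFundamentalMatrix.exists_point {θR : ThetaRing θ R} [Nontrivial R]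
    (hconst : θR.der.constants = Set.range (algebraMap K R)) (hY : θR.IsFundamentalMatrix A Y)
    (σ : θR.autGroup L) : ∃ g : galoisAlgebra K F Y →ₐ[K] L,
      GeneralLinearGroup.map ((σ.val : R ⊗[K] L →ₐ[F] R ⊗[K] L) : R ⊗[K] L →+* R ⊗[K] L)
        (leftGL K L Y) = leftGL K L Y * rightGL K R (GeneralLinearGroup.map
          (g : galoisAlgebra K F Y →+* L) (genericMatrix K F Y)) := by
  let s : R ⊗[K] L →ₐ[F] R ⊗[K] L := σ.val
  let Y' := GeneralLinearGroup.map (s : R ⊗[K] L →+* R ⊗[K] L) (leftGL K L Y)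
  let ι : L →ₐ[K] R ⊗[K] L := Algebra.TensorProduct.includeRight
  -- The map `a ⊗ b ↦ a · σ(b)` carries the Galois matrix to `Y⁻¹ σ(Y)`, whose entries are constants
  -- and so lie in `L`. Its restriction to the Galois algebra is the desired point.
  let h : R ⊗[F] R →ₐ[K] R ⊗[K] L := (Algebra.TensorProduct.lift
    (Algebra.TensorProduct.includeLeft : R →ₐ[F] R ⊗[K] L)
    (s.comp (Algebra.TensorProduct.includeLeft : R →ₐ[F] R ⊗[K] L))
    fun _ _ => Commute.all _ _).restrictScalars K
  have hh : GeneralLinearGroup.map (h : R ⊗[F] R →+* R ⊗[K] L) (galoisMatrix F Y) =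
      (leftGL K L Y)⁻¹ * Y' := by
    have h1 : GeneralLinearGroup.map (h : R ⊗[F] R →+* R ⊗[K] L) (GeneralLinearGroup.map
        ((Algebra.TensorProduct.includeLeft : R →ₐ[F] R ⊗[F] R) : R →+* R ⊗[F] R) Y) =
        leftGL K L Y := by
      ext i j
      simp [h, ← Algebra.TensorProduct.one_def]
    have h2 : GeneralLinearGroup.map (h : R ⊗[F] R →+* R ⊗[K] L) (GeneralLinearGroup.map
        ((Algebra.TensorProduct.includeRight : R →ₐ[F] R ⊗[F] R) : R →+* R ⊗[F] R) Y) = Y' := by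
      ext i j
      simp [h, Y', ← Algebra.TensorProduct.one_def]
    rw [galoisMatrix, map_mul, map_inv, h1, h2]
  have hh' : GeneralLinearGroup.map (h : R ⊗[F] R →+* R ⊗[K] L) (galoisMatrix F Y)⁻¹ =
      Y'⁻¹ * leftGL K L Y := by
    rw [map_inv, hh, _root_.mul_inv_rev, inv_inv]
  have hc := map_inv_mul_eq_const hY.map_extSeries (hY.map_extSeries_autGroup σ)
  have hc' := map_inv_mul_eq_const (hY.map_extSeries_autGroup σ) hY.map_extSeries
  have hle : galoisAlgebra K F Y ≤ ι.range.comap h := by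
    rw [galoisAlgebra_le_iff]
    refine ⟨fun i j => ?_, fun i j => ?_⟩
    · have e : h ((galoisMatrix F Y).val i j) = ((leftGL K L Y)⁻¹ * Y').val i j :=
        congrArg (fun M : GL (Fin n) (R ⊗[K] L) => M.val i j) hh
      rw [Subalgebra.mem_comap, e]
      exact θR.mem_range_includeRight L hconst
        (congrArg (fun M : GL (Fin n) (PowerSeries ((R ⊗[K] L) ⊗[F] S)) => M.val i j) hc)
    · have e : h (((galoisMatrix F Y)⁻¹).val i j) = (Y'⁻¹ * leftGL K L Y).val i j :=
        congrArg (fun M : GL (Fin n) (R ⊗[K] L) => M.val i j) hh'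
      rw [Subalgebra.mem_comap, e]
      exact θR.mem_range_includeRight L hconst
        (congrArg (fun M : GL (Fin n) (PowerSeries ((R ⊗[K] L) ⊗[F] S)) => M.val i j) hc')
  have hι : Function.Injective ι :=
    Algebra.TensorProduct.includeRight_injective (algebraMap K R).injective
  let g : galoisAlgebra K F Y →ₐ[K] L := (AlgEquiv.ofInjective ι hι).symm.toAlgHom.comp
    ((h.comp (galoisAlgebra K F Y).val).codRestrict ι.range fun u => hle u.2)
  have hg : ∀ u, ι (g u) = h u := fun u =>
    congrArg Subtype.val ((AlgEquiv.ofInjective ι hι).apply_symm_apply _)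
  refine ⟨g, ?_⟩
  have : rightGL K R (GeneralLinearGroup.map (g : galoisAlgebra K F Y →+* L)
      (genericMatrix K F Y)) = (leftGL K L Y)⁻¹ * Y' := by
    rw [← hh]
    ext i j
    exact hg _
  rw [this, mul_inv_cancel_left]

theorem rightGL_injective [Nontrivial R] :
    Function.Injective (rightGL K R : GL (Fin n) L → GL (Fin n) (R ⊗[K] L)) := by
  intro C D h
  ext i j
  have hι : Function.Injective (Algebra.TensorProduct.includeRight : L →ₐ[K] R ⊗[K] L) :=
    Algebra.TensorProduct.includeRight_injective (algebraMap K R).injective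
  exact hι (congrArg (fun M : GL (Fin n) (R ⊗[K] L) => M.val i j) h)

/-- The Galois algebra represents the functor of automorphisms. -/
theorem ThetaRing.IsFundamentalMatrix.nonempty_representsAut {θR : ThetaRing θ R}
    (hY : θR.IsFundamentalMatrix A Y) (hsimple : θR.IsSimple)
    (hconst : θR.der.constants = Set.range (algebraMap K R))
    (hgen : Algebra.adjoin F (Set.range (fun ij : Fin n × Fin n => Y.val ij.1 ij.2) ∪
      {((GeneralLinearGroup.det Y)⁻¹).val}) = ⊤) :
    Nonempty (θR.RepresentsAut (galoisAlgebra K F Y)) := by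
  have := hsimple.1
  obtain ⟨ρ, hρ⟩ := exists_coaction hsimple hconst hY hgen
  obtain ⟨S', hS'⟩ := exists_antipode (F := F) K Y
  replace hρ : GeneralLinearGroup.map (ρ : R →+* R ⊗[K] galoisAlgebra K F Y) Y =
    leftGL K _ Y * rightGL K R (genericMatrix K F Y) := hρ
  have hinv : ∀ (L : Type u) [CommRing L] [Algebra K L] (g : galoisAlgebra K F Y →ₐ[K] L),
      GeneralLinearGroup.map ((g.comp S' : galoisAlgebra K F Y →ₐ[K] L) :
        galoisAlgebra K F Y →+* L) (genericMatrix K F Y) =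
      (GeneralLinearGroup.map (g : galoisAlgebra K F Y →+* L) (genericMatrix K F Y))⁻¹ := by
    intro L _ _ g
    rw [← map_inv, ← hS']
    rfl
  -- The antipode supplies the inverse: precomposing `g` with it inverts the matrix `g(Z)`.
  let toAut : ∀ (L : Type u) [CommRing L] [Algebra K L] (g : galoisAlgebra K F Y →ₐ[K] L),
      θR.autGroup L := fun L _ _ g =>
    ⟨AlgEquiv.ofAlgHom (translation ρ g) (translation ρ (g.comp S'))
      (translation_comp_translation hgen hρ (by rw [hinv, mul_inv_cancel]))
      (translation_comp_translation hgen hρ (by rw [hinv, inv_mul_cancel])),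
      translation_one_tmul ρ g, hY.commutes hgen (translation_one_tmul ρ g)
        (map_translation_leftGL hρ g)⟩
  refine ⟨⟨fun L _ _ => Equiv.ofBijective (toAut L) ⟨fun g g' h => ?_, fun σ => ?_⟩,
    fun L L' _ _ _ _ f g x => translation_comp_map ρ g f x⟩⟩
  · have h1 : translation ρ g = translation ρ g' :=
      AlgHom.ext fun x => congrArg (fun σ : θR.autGroup L => σ.val x) h
    have h2 := map_translation_leftGL hρ g
    rw [h1, map_translation_leftGL hρ g'] at h2
    exact (galoisAlgebra_hom_ext K (rightGL_injective (mul_left_cancel h2))).symm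
  · obtain ⟨g, hg⟩ := hY.exists_point hconst σ
    refine ⟨g, Subtype.ext (AlgEquiv.ext fun x => ?_)⟩
    have : translation ρ g = (σ.val : R ⊗[K] L →ₐ[F] R ⊗[K] L) :=
      algHom_ext_of_map_leftGL hgen
        (fun a => (translation_one_tmul ρ g a).trans (σ.2.1 a).symm)
        ((map_translation_leftGL hρ g).trans hg.symm)
    exact DFunLike.congr_fun this x

end ThetaRing

/-- Linear independence of `p`-th powers passes from a domain to its field of fractions. -/
theorem linearIndependent_pow_of_isFractionRing {k R E : Type*} [Field k] [CommRing R] [IsDomain R]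
    [Field E] [Algebra k R] [Algebra R E] [IsFractionRing R E] [Algebra k E] [IsScalarTower k R E]
    {p : ℕ}
    (h : ∀ {ι : Type u} {v : ι → R}, LinearIndependent k v → LinearIndependent k fun i => v i ^ p)
    {ι : Type u} {v : ι → E} (hv : LinearIndependent k v) :
    LinearIndependent k fun i => v i ^ p := by
  rw [linearIndependent_iff_finset_linearIndependent]
  intro s
  -- A common denominator `b` moves the finite family into `R`. Multiplication by `b`, and by `b ^
  -- p` on the `p`-th powers, is injective on `E`.
  obtain ⟨b, hb⟩ := IsLocalization.exist_integer_multiples (nonZeroDivisors R) s v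
  have hb0 : algebraMap R E b ≠ 0 := IsFractionRing.to_map_ne_zero_of_mem_nonZeroDivisors b.2
  have : ∀ i : s, ∃ r : R, algebraMap R E r = algebraMap R E b * v i := fun i => by
    obtain ⟨r, hr⟩ := hb i i.2
    exact ⟨r, hr.trans (Algebra.smul_def _ _)⟩
  choose r hr using this
  have hmul : ∀ c : E, c ≠ 0 → LinearMap.ker (LinearMap.mulLeft k c) = ⊥ := fun c hc =>
    LinearMap.ker_eq_bot.2 (mul_right_injective₀ hc)
  have hE : LinearMap.ker (IsScalarTower.toAlgHom k R E).toLinearMap = ⊥ :=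
    LinearMap.ker_eq_bot.2 (IsFractionRing.injective R E)
  have h1 : LinearIndependent k r := by
    refine LinearIndependent.of_comp (IsScalarTower.toAlgHom k R E).toLinearMap ?_
    rw [show (IsScalarTower.toAlgHom k R E).toLinearMap ∘ r =
      LinearMap.mulLeft k (algebraMap R E b) ∘ (v ∘ Subtype.val) from funext hr]
    exact (hv.comp (Subtype.val : s → ι) Subtype.val_injective).map' _ (hmul _ hb0)
  have h2 := (h h1).map' _ hE
  refine LinearIndependent.of_comp (LinearMap.mulLeft k (algebraMap R E b ^ p)) ?_
  rwa [show LinearMap.mulLeft k (algebraMap R E b ^ p) ∘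
      ((fun i => v i ^ p) ∘ (Subtype.val : s → ι)) =
    (IsScalarTower.toAlgHom k R E).toLinearMap ∘ fun i => r i ^ p by
      funext i
      simp [hr, mul_pow]]

end PPV

end

theorem corollary10p5 {K F S : Type u} [Field K] [Field F] [CommRing S]
    [Algebra K F] [Algebra F S] [Algebra K S] [IsScalarTower K F S]
    (𝒜 : ℕ → Submodule F S) [GradedAlgebra 𝒜]
    (hbase : PPV.IsCgaOverBase 𝒜) (hdom : NoZeroDivisors (PPV.cga 𝒜))
    (θ : PPV.HigherDerivation K 𝒜) (hθ : θ.IsIterable)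
    (hconst : θ.constants = Set.range (algebraMap K F))
    (p : ℕ) (hp : 0 < p) [CharP F p]
    (hker : {x : F | θ.comp 1 x = 0} = Set.range (fun x : F => x ^ p))
    {n : ℕ} (A : GL (Fin n) (PPV.cga 𝒜)) (hA : PPV.IsIHDE θ A)
    {R : Type u} [CommRing R] [Algebra F R] [Algebra K R] [IsScalarTower K F R]
    (θR : PPV.ThetaRing θ R) (hR : θR.IsPPVRing A)
    {E : Type u} [Field E] [Algebra R E] [IsFractionRing R E]
    [Algebra F E] [IsScalarTower F R E] :
    PPV.IsSeparableExtension F E ∧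
      ∃ (U : Type u) (_ : CommRing U) (_ : Algebra K U),
        Algebra.FiniteType K U ∧ Nonempty (θR.RepresentsAut U) ∧
          AlgebraicGeometry.IsReduced (AlgebraicGeometry.Spec (CommRingCat.of U)) := by
  have : Fact p.Prime := ⟨(CharP.char_is_prime_or_zero F p).resolve_right hp.ne'⟩
  have : IsDomain R := (IsFractionRing.injective R E).isDomain (algebraMap R E)
  have hpow : ∀ {ι : Type u} {v : ι → R}, LinearIndependent F v →
      LinearIndependent F fun i => v i ^ p := fun hv => θR.linearIndependent_pow p hker hv
  refine ⟨fun F' _ _ => PPV.isReduced_tensorProduct_of_linearIndependent_pow p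
    fun _ _ hv => PPV.linearIndependent_pow_of_isFractionRing hpow hv, ?_⟩
  obtain ⟨Y, hY, hgen⟩ := hR.fundamental
  refine ⟨PPV.galoisAlgebra K F Y, inferInstance, inferInstance, inferInstance,
    hY.nonempty_representsAut hR.simple hR.constants_eq hgen, ?_⟩
  -- The criterion with `R` in both factors; the Galois algebra inherits reducedness as a subring.
  have : IsReduced (R ⊗[F] R) :=
    PPV.isReduced_tensorProduct_of_linearIndependent_pow p fun _ _ hv => hpow hv
  have : IsReduced (PPV.galoisAlgebra K F Y) :=
    isReduced_of_injective (PPV.galoisAlgebra K F Y).val Subtype.val_injective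
  infer_instance
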